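/- Let $d\in\mathbb N$ and let $\mathbb D(\mathbb R_+,\mathbb R^d)$ be the set of càdlàg functions $\mathbb R_+\to\mathbb R^d$ (right continuous with left limits). Equip it with the Skorokhod $J_1$ metric $$d_\infty^\circ(f,g)=\sum_{m=1}^\infty 2^{-m}\bigl(1\wedge d_m^\circ(f^{(m)},g^{(m)})\bigr),\qquad f^{(m)}(t)=(1\wedge(m-t))^+f(t),$$ $$d_m^\circ(f,g)=\inf_{\lambda\in\Lambda_m}\Bigl\{\Bigl(\sup_{0\le s<t\le m}\Bigl|\log\tfrac{\lambda(t)-\lambda(s)}{t-s}\Bigr|\Bigr)\vee\sup_{t\in[0,m]}\|f(t)-g(\lambda(t))\|\Bigr\},$$ where $\Lambda_m$ is the set of strictly increasing continuous maps of $[0,m]$ onto itself and $\|\cdot\|$ is the Euclidean norm, and with the Borel $\sigma$-algebra of this metric. Define $\Phi,\Phi_n:\mathbb D(\mathbb R_+,\mathbb R^d)\to\mathbb D(\mathbb R_+,\mathbb R^{3d})$, $n\in\mathbb N$, by $$\Phi(f)(t)=\begin{bmatrix} f(t)\\ \int_0^t f(s)\,ds\\ \int_0^t\bigl(\int_0^r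 f(s)\,ds\bigr)dr\end{bmatrix},\qquad \Phi_n(f)(t)=\begin{bmatrix} f(t)\\ \int_0^{\lfloor nt\rfloor/n} f(s)\,ds\\ \int_0^{\lfloor nt\rfloor/n}\bigl(\int_0^{\lfloor nr\rfloor/n} f(s)\,ds\bigr)dr\end{bmatrix},\qquad t\in\mathbb R_+.$$ Let $(U_t)_{t\in\mathbb R_+}$ and $(U^{(n)}_t)_{t\in\mathbb R_+}$, $n\in\mathbb N$, be $\mathbb R^d$-valued stochastic processes with càdlàg paths (possibly defined on different probability spaces) such that $U$ has continuous paths almost surely and the distribution of $U^{(n)}$ on $\mathbb D(\mathbb R_+,\mathbb R^d)$ converges weakly to that of $U$ as $n\to\infty$. Then the distribution of $\Phi_n(U^{(n)})$ on $\mathbb D(\mathbb R_+,\mathbb R^{3d})$ converges weakly to that of $\Phi(U)$ as $n\to\infty$. -/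

import Mathlib

open Filter Topology MeasureTheory ProbabilityTheory Set
open scoped NNReal ENNReal

noncomputable section

/-- A function on `[0, ∞)` is càdlàg if it is right continuous and has (finite) left limits.
At `t = 0` the left-limit condition is void. -/
def IsCadlag {E : Type*} [TopologicalSpace E] (f : ℝ≥0 → E) : Prop :=
  ∀ t, ContinuousWithinAt f (Ici t) t ∧ ∃ l, Tendsto f (𝓝[<] t) (𝓝 l)

/-- The set `D([0, ∞), E)` of càdlàg functions. -/
structure CadlagPath (E : Type*) [TopologicalSpace E] where
  toFun : ℝ≥0 → E
  isCadlag' : IsCadlag toFun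

namespace CadlagPath

instance {E : Type*} [TopologicalSpace E] : CoeFun (CadlagPath E) (fun _ => ℝ≥0 → E) :=
  ⟨CadlagPath.toFun⟩

end CadlagPath

/-! ### The Skorokhod `J₁` metric -/

section Skorokhod

/-- The time changes of `[0, m]`: the strictly increasing (continuous) maps of `[0, m]` onto
itself, that is, the order automorphisms of `[0, m]` (continuity is automatic). -/
abbrev TimeChange (m : ℕ) : Type := Icc (0 : ℝ≥0) m ≃o Icc (0 : ℝ≥0) m

/-- `‖lam‖ = sup_{0 ≤ s < t ≤ m} |log ((lam t - lam s) / (t - s))|`, with values in `[0, ∞]`. -/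
def TimeChange.logNorm {m : ℕ} (lam : TimeChange m) : ℝ≥0∞ :=
  ⨆ (s : Icc (0 : ℝ≥0) m) (t : Icc (0 : ℝ≥0) m) (_ : s < t),
    ENNReal.ofReal |Real.log ((((lam t : ℝ≥0) : ℝ) - ((lam s : ℝ≥0) : ℝ)) /
      (((t : ℝ≥0) : ℝ) - ((s : ℝ≥0) : ℝ)))|

/-- The distance of two functions on `[0, m]`:
`inf_lam max(‖lam‖, sup_{t ∈ [0, m]} ‖f t - g (lam t)‖)`. -/
def skorokhodDistOn {E : Type*} [NormedAddCommGroup E] (m : ℕ) (f g : ℝ≥0 → E) : ℝ≥0∞ :=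
  ⨅ lam : TimeChange m,
    max lam.logNorm (⨆ t : Icc (0 : ℝ≥0) m, edist (f t) (g (lam t)))

/-- `f^{(m)}(t) = (1 ∧ (m - t))⁺ f(t)`. -/
def cutAt {E : Type*} [NormedAddCommGroup E] [NormedSpace ℝ E] (m : ℕ) (f : ℝ≥0 → E) (t : ℝ≥0) :
    E :=
  max (min 1 ((m : ℝ) - (t : ℝ))) 0 • f t

/-- The Skorokhod distance `∑_{m ≥ 1} 2^{-m} (1 ∧ d_m(f^{(m)}, g^{(m)}))`. -/
def skorokhodDist {E : Type*} [NormedAddCommGroup E] [NormedSpace ℝ E] (f g : ℝ≥0 → E) : ℝ≥0∞ :=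
  ∑' k : ℕ, 2⁻¹ ^ (k + 1) * min 1 (skorokhodDistOn (k + 1) (cutAt (k + 1) f) (cutAt (k + 1) g))

theorem TimeChange.logNorm_refl (m : ℕ) : TimeChange.logNorm (OrderIso.refl _ : TimeChange m) = 0 := by
  simp only [TimeChange.logNorm, OrderIso.refl_apply, ENNReal.iSup_eq_zero]
  intro s t h
  have h' : ((s : ℝ≥0) : ℝ) < ((t : ℝ≥0) : ℝ) := by exact_mod_cast h
  rw [div_self (by linarith)]
  simp

theorem TimeChange.logNorm_symm_le {m : ℕ} (lam : TimeChange m) :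
    TimeChange.logNorm lam.symm ≤ TimeChange.logNorm lam := by
  refine iSup_le fun s => iSup_le fun t => iSup_le fun h => ?_
  refine le_trans (le_of_eq ?_) (le_iSup_of_le (lam.symm s) (le_iSup_of_le (lam.symm t)
    (le_iSup_of_le (lam.symm.strictMono h) le_rfl)))
  rw [lam.apply_symm_apply, lam.apply_symm_apply, ← abs_neg, ← Real.log_inv, inv_div]

theorem TimeChange.logNorm_trans_le {m : ℕ} (lam mu : TimeChange m) :
    TimeChange.logNorm (lam.trans mu) ≤ TimeChange.logNorm lam + TimeChange.logNorm mu := by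
  refine iSup_le fun s => iSup_le fun t => iSup_le fun h => ?_
  have h0 : ((s : ℝ≥0) : ℝ) < ((t : ℝ≥0) : ℝ) := by exact_mod_cast h
  have h1 : ((lam s : ℝ≥0) : ℝ) < ((lam t : ℝ≥0) : ℝ) := by exact_mod_cast lam.strictMono h
  have h2 : ((mu (lam s) : ℝ≥0) : ℝ) < ((mu (lam t) : ℝ≥0) : ℝ) := by
    exact_mod_cast mu.strictMono (lam.strictMono h)
  have e1 := le_iSup_of_le (f := fun s : Icc (0 : ℝ≥0) m =>
    ⨆ (t : Icc (0 : ℝ≥0) m) (_ : s < t), ENNReal.ofReal |Real.log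
      ((((lam t : ℝ≥0) : ℝ) - ((lam s : ℝ≥0) : ℝ)) / (((t : ℝ≥0) : ℝ) - ((s : ℝ≥0) : ℝ)))|)
    s (le_iSup_of_le t (le_iSup_of_le h le_rfl))
  have e2 := le_iSup_of_le (f := fun s : Icc (0 : ℝ≥0) m =>
    ⨆ (t : Icc (0 : ℝ≥0) m) (_ : s < t), ENNReal.ofReal |Real.log
      ((((mu t : ℝ≥0) : ℝ) - ((mu s : ℝ≥0) : ℝ)) / (((t : ℝ≥0) : ℝ) - ((s : ℝ≥0) : ℝ)))|)
    (lam s) (le_iSup_of_le (lam t) (le_iSup_of_le (lam.strictMono h) le_rfl))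
  refine le_trans ?_ (add_le_add e1 e2)
  rw [← ENNReal.ofReal_add (abs_nonneg _) (abs_nonneg _)]
  refine ENNReal.ofReal_le_ofReal (le_trans (le_of_eq ?_) (abs_add_le _ _))
  rw [← Real.log_mul (div_pos (by linarith) (by linarith)).ne'
    (div_pos (by linarith) (by linarith)).ne', OrderIso.trans_apply, OrderIso.trans_apply]
  congr 2
  have : ((lam t : ℝ≥0) : ℝ) - ((lam s : ℝ≥0) : ℝ) ≠ 0 := by linarith
  have : ((t : ℝ≥0) : ℝ) - ((s : ℝ≥0) : ℝ) ≠ 0 := by linarith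
  field_simp

variable {E : Type*} [NormedAddCommGroup E]

theorem skorokhodDistOn_self (m : ℕ) (f : ℝ≥0 → E) : skorokhodDistOn m f f = 0 := by
  refine le_antisymm (iInf_le_of_le (OrderIso.refl _) ?_) bot_le
  simp [TimeChange.logNorm_refl]

theorem skorokhodDistOn_comm_le (m : ℕ) (f g : ℝ≥0 → E) :
    skorokhodDistOn m g f ≤ skorokhodDistOn m f g := by
  refine le_iInf fun lam => iInf_le_of_le lam.symm (max_le_max lam.logNorm_symm_le ?_)
  refine iSup_le fun t => le_iSup_of_le (lam.symm t) ?_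
  rw [lam.apply_symm_apply, edist_comm]

theorem skorokhodDistOn_comm (m : ℕ) (f g : ℝ≥0 → E) :
    skorokhodDistOn m f g = skorokhodDistOn m g f :=
  le_antisymm (skorokhodDistOn_comm_le _ _ _) (skorokhodDistOn_comm_le _ _ _)

theorem skorokhodDistOn_triangle (m : ℕ) (f g h : ℝ≥0 → E) :
    skorokhodDistOn m f h ≤ skorokhodDistOn m f g + skorokhodDistOn m g h := by
  unfold skorokhodDistOn
  refine ENNReal.le_iInf_add_iInf fun lam mu => ?_
  refine iInf_le_of_le (lam.trans mu) (max_le ?_ ?_)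
  · exact (TimeChange.logNorm_trans_le lam mu).trans
      (add_le_add (le_max_left _ _) (le_max_left _ _))
  · refine iSup_le fun t => (edist_triangle _ (g (lam t)) _).trans ?_
    exact add_le_add
      ((le_iSup (fun t : Icc (0 : ℝ≥0) m => edist (f t) (g (lam t))) t).trans (le_max_right _ _))
      ((le_iSup (fun t : Icc (0 : ℝ≥0) m => edist (g t) (h (mu t))) (lam t)).trans
        (le_max_right _ _))

variable [NormedSpace ℝ E]

/-- `D([0, ∞), E)` with the Skorokhod metric; it carries the topology of this metric (the `J₁`
topology). -/
instance CadlagPath.instPseudoEMetricSpace : PseudoEMetricSpace (CadlagPath E) where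
  edist f g := skorokhodDist f.toFun g.toFun
  edist_self f := by simp [skorokhodDist, skorokhodDistOn_self]
  edist_comm f g := by simp only [skorokhodDist, skorokhodDistOn_comm]
  edist_triangle f g h := by
    simp only [skorokhodDist]
    rw [← ENNReal.tsum_add]
    refine ENNReal.tsum_le_tsum fun k => ?_
    rw [← mul_add]
    refine mul_le_mul_right ?_ _
    refine (min_le_min le_rfl (skorokhodDistOn_triangle _ _ (cutAt (k + 1) g.toFun) _)).trans ?_
    rcases le_total 1 (skorokhodDistOn (k + 1) (cutAt (k + 1) f.toFun) (cutAt (k + 1) g.toFun))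
      with h1 | h1
    · rw [min_eq_left h1]
      exact (min_le_left _ _).trans le_self_add
    · rcases le_total 1 (skorokhodDistOn (k + 1) (cutAt (k + 1) g.toFun) (cutAt (k + 1) h.toFun))
        with h2 | h2
      · rw [min_eq_left h2]
        exact (min_le_left _ _).trans le_add_self
      · rw [min_eq_right h1, min_eq_right h2]
        exact min_le_right _ _

/-- The Borel `σ`-algebra of the `J₁` topology. -/
instance CadlagPath.instMeasurableSpace : MeasurableSpace (CadlagPath E) := borel _

instance CadlagPath.instBorelSpace : BorelSpace (CadlagPath E) := ⟨rfl⟩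

end Skorokhod

/-! ### Integrals of càdlàg functions -/

section Integrals

/-- `∫₀ᵗ f(s) ds`. -/
def primitive {E : Type*} [NormedAddCommGroup E] [NormedSpace ℝ E] (f : ℝ≥0 → E) (t : ℝ≥0) : E :=
  ∫ s in (0 : ℝ)..(t : ℝ), f s.toNNReal

/-- `⌊n t⌋ / n`. -/
def gridFloor (n : ℕ) (t : ℝ≥0) : ℝ≥0 := (⌊(n : ℝ≥0) * t⌋₊ : ℝ≥0) / (n : ℝ≥0)

theorem IsCadlag.continuous_comp {E F : Type*} [TopologicalSpace E] [TopologicalSpace F]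
    {f : ℝ≥0 → E} (hf : IsCadlag f) {g : E → F} (hg : Continuous g) :
    IsCadlag (fun t => g (f t)) := fun t => by
  obtain ⟨h1, l, hl⟩ := hf t
  exact ⟨hg.continuousAt.comp_continuousWithinAt h1, g l, (hg.tendsto l).comp hl⟩

theorem IsCadlag.prodMk {E F : Type*} [TopologicalSpace E] [TopologicalSpace F]
    {f : ℝ≥0 → E} (hf : IsCadlag f) {g : ℝ≥0 → F} (hg : IsCadlag g) :
    IsCadlag (fun t => (f t, g t)) := fun t => by
  obtain ⟨h1, l, hl⟩ := hf t
  obtain ⟨h2, k, hk⟩ := hg t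
  exact ⟨h1.prodMk h2, (l, k), hl.prodMk_nhds hk⟩

theorem Continuous.isCadlag {E : Type*} [TopologicalSpace E] {f : ℝ≥0 → E} (hf : Continuous f) :
    IsCadlag f := fun t =>
  ⟨hf.continuousWithinAt, f t, (hf.tendsto t).mono_left nhdsWithin_le_nhds⟩

theorem gridFloor_eventually_right (n : ℕ) (t : ℝ≥0) :
    ∀ᶠ s in 𝓝[≥] t, gridFloor n s = gridFloor n t := by
  have hlt : (n : ℝ≥0) * t < (⌊(n : ℝ≥0) * t⌋₊ : ℝ≥0) + 1 := Nat.lt_floor_add_one _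
  have hc : Tendsto (fun s : ℝ≥0 => (n : ℝ≥0) * s) (𝓝[≥] t) (𝓝 ((n : ℝ≥0) * t)) :=
    ((continuous_const.mul continuous_id).tendsto t).mono_left nhdsWithin_le_nhds
  filter_upwards [hc.eventually_lt_const hlt, self_mem_nhdsWithin] with s hs hst
  have : ⌊(n : ℝ≥0) * s⌋₊ = ⌊(n : ℝ≥0) * t⌋₊ := by
    rw [Nat.floor_eq_iff (zero_le)]
    exact ⟨(Nat.floor_le (zero_le)).trans (mul_le_mul_right hst _), hs⟩
  rw [gridFloor, gridFloor, this]

theorem gridFloor_eventually_left (n : ℕ) (t : ℝ≥0) :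
    ∃ a, ∀ᶠ s in 𝓝[<] t, gridFloor n s = a := by
  rcases Nat.eq_zero_or_pos n with rfl | hn
  · exact ⟨0, Eventually.of_forall fun s => by simp [gridFloor]⟩
  rcases eq_or_ne t 0 with rfl | ht
  · refine ⟨0, ?_⟩
    have : Iio (0 : ℝ≥0) = ∅ := by ext; simp
    rw [this, nhdsWithin_empty]
    exact eventually_bot
  have hn' : (0 : ℝ≥0) < n := by exact_mod_cast hn
  have hpos : 0 < (n : ℝ≥0) * t := mul_pos hn' (pos_iff_ne_zero.2 ht)
  obtain ⟨k, hk⟩ : ∃ k, ⌈(n : ℝ≥0) * t⌉₊ = k + 1 :=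
    Nat.exists_eq_succ_of_ne_zero (Nat.ceil_pos.2 hpos).ne'
  have hkt : (k : ℝ≥0) < (n : ℝ≥0) * t := by
    rw [← Nat.lt_ceil, hk]; exact Nat.lt_succ_self k
  have htk : (n : ℝ≥0) * t ≤ (k : ℝ≥0) + 1 := by
    have := Nat.le_ceil ((n : ℝ≥0) * t)
    rw [hk] at this; exact_mod_cast this
  have hc : Tendsto (fun s : ℝ≥0 => (n : ℝ≥0) * s) (𝓝[<] t) (𝓝 ((n : ℝ≥0) * t)) :=
    ((continuous_const.mul continuous_id).tendsto t).mono_left nhdsWithin_le_nhds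
  refine ⟨(k : ℝ≥0) / n, ?_⟩
  filter_upwards [hc.eventually_const_lt hkt, self_mem_nhdsWithin] with s hs hst
  have : ⌊(n : ℝ≥0) * s⌋₊ = k := by
    rw [Nat.floor_eq_iff (zero_le)]
    exact ⟨hs.le, (mul_lt_mul_of_pos_left hst hn').trans_le htk⟩
  rw [gridFloor, this]

theorem isCadlag_comp_gridFloor {E : Type*} [TopologicalSpace E] (n : ℕ) (u : ℝ≥0 → E) :
    IsCadlag (fun t => u (gridFloor n t)) := fun t => by
  constructor
  · refine Tendsto.congr' ?_ tendsto_const_nhds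
    filter_upwards [gridFloor_eventually_right n t] with s hs
    rw [hs]
  · obtain ⟨a, ha⟩ := gridFloor_eventually_left n t
    refine ⟨u a, Tendsto.congr' ?_ tendsto_const_nhds⟩
    filter_upwards [ha] with s hs
    rw [hs]

variable {E : Type*} [NormedAddCommGroup E]

theorem IsCadlag.exists_bound {f : ℝ≥0 → E} (hf : IsCadlag f) (T : ℝ≥0) :
    ∃ C : ℝ, ∀ t ∈ Icc 0 T, ‖f t‖ ≤ C := by
  refine isCompact_Icc.induction_on (p := fun s : Set ℝ≥0 => ∃ C : ℝ, ∀ t ∈ s, ‖f t‖ ≤ C)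
    ⟨0, by simp⟩ (fun s t hst ⟨C, hC⟩ => ⟨C, fun x hx => hC x (hst hx)⟩)
    (fun s t ⟨C, hC⟩ ⟨D, hD⟩ => ⟨max C D, fun x hx => hx.elim
      (fun h => (hC x h).trans (le_max_left _ _)) (fun h => (hD x h).trans (le_max_right _ _))⟩)
    fun x _ => ?_
  obtain ⟨h1, l, hl⟩ := hf x
  have e1 : ∀ᶠ s in 𝓝[≥] x, ‖f s‖ ≤ max (‖f x‖ + 1) (‖l‖ + 1) :=
    (h1.norm.eventually_lt_const (lt_add_one _)).mono fun s hs => hs.le.trans (le_max_left _ _)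
  have e2 : ∀ᶠ s in 𝓝[<] x, ‖f s‖ ≤ max (‖f x‖ + 1) (‖l‖ + 1) :=
    (hl.norm.eventually_lt_const (lt_add_one _)).mono fun s hs => hs.le.trans (le_max_right _ _)
  have e3 : ∀ᶠ s in 𝓝 x, ‖f s‖ ≤ max (‖f x‖ + 1) (‖l‖ + 1) := by
    rw [← nhdsLT_sup_nhdsGE]
    exact eventually_sup.2 ⟨e2, e1⟩
  exact ⟨_, mem_nhdsWithin_of_mem_nhds e3, _, fun t ht => ht⟩

theorem IsCadlag.stronglyMeasurable {f : ℝ≥0 → E} (hf : IsCadlag f) :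
    StronglyMeasurable f := by
  have key : ∀ k : ℕ, StronglyMeasurable
      (fun t : ℝ≥0 => f (((⌊((k : ℝ≥0) + 1) * t⌋₊ : ℝ≥0) + 1) / ((k : ℝ≥0) + 1))) := fun k => by
    have hm : Measurable (fun t : ℝ≥0 => ⌊((k : ℝ≥0) + 1) * t⌋₊) :=
      Nat.measurable_floor.comp (measurable_const.mul measurable_id)
    exact (StronglyMeasurable.of_discrete
      (f := fun j : ℕ => f (((j : ℝ≥0) + 1) / ((k : ℝ≥0) + 1)))).comp_measurable hm
  refine stronglyMeasurable_of_tendsto atTop key (tendsto_pi_nhds.2 fun t => ?_)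
  refine Tendsto.comp (hf t).1 (tendsto_nhdsWithin_iff.2 ⟨?_, Eventually.of_forall fun k => ?_⟩)
  · have h1 : Tendsto (fun k : ℕ => t + 1 / ((k : ℝ≥0) + 1)) atTop (𝓝 t) := by
      simpa using tendsto_const_nhds.add (tendsto_one_div_add_atTop_nhds_zero_nat (𝕜 := ℝ≥0))
    refine tendsto_of_tendsto_of_tendsto_of_le_of_le tendsto_const_nhds h1 (fun k => ?_)
      (fun k => ?_)
    · have hk : (0 : ℝ≥0) < (k : ℝ≥0) + 1 := by positivity
      show t ≤ _
      rw [le_div_iff₀ hk, mul_comm]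
      exact (Nat.lt_floor_add_one _).le
    · have hk : (0 : ℝ≥0) < (k : ℝ≥0) + 1 := by positivity
      show _ ≤ t + 1 / ((k : ℝ≥0) + 1)
      rw [add_div]
      refine add_le_add_left ?_ _
      rw [div_le_iff₀ hk, mul_comm]
      exact Nat.floor_le (zero_le)
  · have hk : (0 : ℝ≥0) < (k : ℝ≥0) + 1 := by positivity
    show t ≤ _
    rw [le_div_iff₀ hk, mul_comm]
    exact (Nat.lt_floor_add_one _).le

theorem IsCadlag.intervalIntegrable {f : ℝ≥0 → E} (hf : IsCadlag f) (a b : ℝ) :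
    IntervalIntegrable (fun s : ℝ => f s.toNNReal) volume a b := by
  obtain ⟨C, hC⟩ := hf.exists_bound (max a b).toNNReal
  rw [intervalIntegrable_iff]
  refine Measure.integrableOn_of_bounded (M := C) (by simp)
    (hf.stronglyMeasurable.comp_measurable measurable_real_toNNReal).aestronglyMeasurable ?_
  refine (ae_restrict_iff' measurableSet_uIoc).2 (Eventually.of_forall fun s hs => ?_)
  exact hC _ ⟨zero_le, Real.toNNReal_le_toNNReal hs.2⟩

variable [NormedSpace ℝ E]

theorem IsCadlag.continuous_primitive {f : ℝ≥0 → E} (hf : IsCadlag f) :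
    Continuous (primitive f) :=
  (intervalIntegral.continuous_primitive hf.intervalIntegrable 0).comp NNReal.continuous_coe

end Integrals

/-! ### The mappings `Φ` and `Φₙ` -/

section Mappings

/-- The column vector `[x, y, z]ᵀ ∈ ℝ^{3d}` made of the three blocks `x, y, z ∈ ℝ^d`:
the coordinate with (zero-based) index `d * i + j` is the `j`-th coordinate of the `i`-th block. -/
def stack {d : ℕ} (x y z : EuclideanSpace ℝ (Fin d)) : EuclideanSpace ℝ (Fin (3 * d)) :=
  WithLp.toLp 2 fun k => ![x, y, z] (finProdFinEquiv.symm k).1 (finProdFinEquiv.symm k).2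

theorem continuous_stack (d : ℕ) :
    Continuous fun p : EuclideanSpace ℝ (Fin d) × EuclideanSpace ℝ (Fin d) ×
      EuclideanSpace ℝ (Fin d) => stack p.1 p.2.1 p.2.2 := by
  refine (PiLp.continuous_toLp 2 _).comp (continuous_pi fun k => ?_)
  generalize finProdFinEquiv.symm k = q
  obtain ⟨i, j⟩ := q
  fin_cases i <;> simp <;> fun_prop

/-- `Φ(f)(t) = [f(t), ∫₀ᵗ f(s) ds, ∫₀ᵗ (∫₀ʳ f(s) ds) dr]ᵀ`. -/
def iteratedIntegralMap {d : ℕ} (f : CadlagPath (EuclideanSpace ℝ (Fin d))) :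
    CadlagPath (EuclideanSpace ℝ (Fin (3 * d))) where
  toFun t := stack (f t) (primitive f t) (primitive (fun r => primitive f r) t)
  isCadlag' :=
    (f.isCadlag'.prodMk (f.isCadlag'.continuous_primitive.isCadlag.prodMk
      f.isCadlag'.continuous_primitive.isCadlag.continuous_primitive.isCadlag)).continuous_comp
      (continuous_stack d)

/-- `Φₙ(f)(t) = [f(t), ∫₀^{⌊nt⌋/n} f(s) ds, ∫₀^{⌊nt⌋/n} (∫₀^{⌊nr⌋/n} f(s) ds) dr]ᵀ`. -/
def discreteIteratedIntegralMap {d : ℕ} (n : ℕ) (f : CadlagPath (EuclideanSpace ℝ (Fin d))) :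
    CadlagPath (EuclideanSpace ℝ (Fin (3 * d))) where
  toFun t := stack (f t) (primitive f (gridFloor n t))
    (primitive (fun r => primitive f (gridFloor n r)) (gridFloor n t))
  isCadlag' :=
    have h1 : IsCadlag fun t => primitive f (gridFloor n t) := isCadlag_comp_gridFloor n _
    have h2 : IsCadlag fun t => primitive (fun r => primitive f (gridFloor n r)) (gridFloor n t) :=
      isCadlag_comp_gridFloor n (primitive fun r => primitive f (gridFloor n r))
    (f.isCadlag'.prodMk (h1.prodMk h2)).continuous_comp (continuous_stack d)

end Mappings

end

/-! The map `Φ` is continuous for `J₁`, and `Φₙ` is close to `Φ` uniformly over paths with a common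
bound on a compact interval; the closed-set form of the portmanteau theorem combines the two facts.

Continuity: if paths converge in `J₁`, they converge at every continuity point of the limit, hence
off a countable set, and are locally bounded. Dominated convergence then makes the primitives, and
so the iterated primitives, converge uniformly on compacts
(`CadlagPath.tendstoUniformlyOn_primitive`). Their limits are continuous, so the time change that
serves the path serves all three blocks (`CadlagPath.tendsto_stack`).

Approximation: replacing `t` by `⌊nt⌋/n` shortens a range of integration by at most `1/n`, so on
`[0, M]` the error is `O(1/n)` when the path is bounded there
(`eventually_edist_discreteIteratedIntegralMap_le`). The exceptional large paths form a closed set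
whose mass under the limit law vanishes as the bound grows.

Measurability of `Φₙ` is checked coordinatewise (`CadlagPath.measurable_of_apply`), because a path
is the `J₁` limit of its grid samples (`CadlagPath.tendsto_stepPath_sample`). -/

noncomputable section

/-! ### `J₁` convergence in terms of time changes. -/

section SkorokhodConvergence

variable {E : Type*} [NormedAddCommGroup E]

theorem TimeChange.abs_log_le {m : ℕ} (lam : TimeChange m) {δ : ℝ} (hδ : 0 ≤ δ)
    (h : lam.logNorm ≤ ENNReal.ofReal δ) {s t : Icc (0 : ℝ≥0) m} (hst : s < t) :
    |Real.log ((((lam t : ℝ≥0) : ℝ) - ((lam s : ℝ≥0) : ℝ)) /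
      (((t : ℝ≥0) : ℝ) - ((s : ℝ≥0) : ℝ)))| ≤ δ := by
  rw [← ENNReal.ofReal_le_ofReal_iff hδ]
  exact le_trans (le_iSup_of_le (f := fun s : Icc (0 : ℝ≥0) m =>
    ⨆ (t : Icc (0 : ℝ≥0) m) (_ : s < t), ENNReal.ofReal |Real.log
      ((((lam t : ℝ≥0) : ℝ) - ((lam s : ℝ≥0) : ℝ)) / (((t : ℝ≥0) : ℝ) - ((s : ℝ≥0) : ℝ)))|)
    s (le_iSup_of_le t (le_iSup_of_le hst le_rfl))) h

/-- A time change fixes `0`, so the slope bound on the pair `0 < t` puts `lam t / t` between `exp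
(-δ)` and `exp δ`; then `t ≤ m`. -/
theorem TimeChange.abs_apply_sub_le {m : ℕ} (lam : TimeChange m) {δ : ℝ} (hδ : 0 ≤ δ)
    (h : lam.logNorm ≤ ENNReal.ofReal δ) (t : Icc (0 : ℝ≥0) m) :
    |((lam t : ℝ≥0) : ℝ) - ((t : ℝ≥0) : ℝ)| ≤ m * (Real.exp δ - 1) := by
  have hexp : 0 ≤ Real.exp δ - 1 := by linarith [Real.add_one_le_exp δ]
  set z : Icc (0 : ℝ≥0) m := ⟨0, le_rfl, zero_le⟩ with hz
  have hbot : ∀ x : Icc (0 : ℝ≥0) m, z ≤ x := fun x => Subtype.coe_le_coe.1 (zero_le)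
  have hz0 : lam z = z :=
    le_antisymm (by simpa using lam.monotone (hbot (lam.symm z))) (hbot _)
  rcases (hbot t).eq_or_lt with rfl | hlt
  · rw [hz0]; simpa using mul_nonneg (Nat.cast_nonneg m) hexp
  have hb := lam.abs_log_le hδ h hlt
  rw [hz0] at hb
  have hzr : ((z : ℝ≥0) : ℝ) = 0 := by simp [hz]
  rw [hzr, sub_zero, sub_zero] at hb
  have ht : (0 : ℝ) < ((t : ℝ≥0) : ℝ) := by rw [← hzr]; exact_mod_cast hlt
  have hlt' : (0 : ℝ) < ((lam t : ℝ≥0) : ℝ) := by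
    have := lam.strictMono hlt
    rw [hz0] at this
    rw [← hzr]; exact_mod_cast this
  have hq : 0 < ((lam t : ℝ≥0) : ℝ) / ((t : ℝ≥0) : ℝ) := div_pos hlt' ht
  obtain ⟨h1, h2⟩ := abs_le.1 hb
  have h2' := (Real.log_le_iff_le_exp hq).1 h2
  have h1' := (Real.le_log_iff_exp_le hq).1 h1
  have htm : ((t : ℝ≥0) : ℝ) ≤ m := by exact_mod_cast t.2.2
  -- This is `exp δ + exp (-δ) ≥ 2`: the downward deviation obeys the same bound `exp δ - 1` as the
  -- upward one.
  have h3 : 2 - Real.exp δ ≤ Real.exp (-δ) := by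
    have hpos := Real.exp_pos δ
    rw [Real.exp_neg, ← one_div, le_div_iff₀ hpos]
    nlinarith [sq_nonneg (Real.exp δ - 1)]
  rw [div_le_iff₀ ht] at h2'
  rw [le_div_iff₀ ht] at h1'
  rw [abs_le]
  constructor <;> nlinarith

theorem tendsto_skorokhodDistOn_zero {ι : Type*} {l : Filter ι} {m : ℕ} {F : ι → ℝ≥0 → E}
    {G : ℝ≥0 → E}
    (h : ∀ ε : ℝ, 0 < ε → ∀ᶠ i in l, ∃ lam : TimeChange m, lam.logNorm ≤ ENNReal.ofReal ε ∧
      ∀ t : Icc (0 : ℝ≥0) m, dist (F i t) (G (lam t)) ≤ ε) :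
    Tendsto (fun i => skorokhodDistOn m (F i) G) l (𝓝 0) := by
  rw [ENNReal.tendsto_nhds_zero]
  intro ε hε
  obtain ⟨δ, hδ, hδε⟩ : ∃ δ : ℝ, 0 < δ ∧ ENNReal.ofReal δ ≤ ε := by
    rcases eq_or_ne ε ⊤ with rfl | h'
    · exact ⟨1, one_pos, le_top⟩
    · exact ⟨ε.toReal, ENNReal.toReal_pos hε.ne' h', ENNReal.ofReal_toReal_le⟩
  filter_upwards [h δ hδ] with i ⟨lam, h1, h2⟩
  refine iInf_le_of_le lam (max_le (h1.trans hδε) (iSup_le fun t => ?_))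
  rw [edist_dist]
  exact (ENNReal.ofReal_le_ofReal (h2 t)).trans hδε

theorem exists_timeChange_of_tendsto {ι : Type*} {l : Filter ι} {m : ℕ} {F : ι → ℝ≥0 → E}
    {G : ℝ≥0 → E} (h : Tendsto (fun i => skorokhodDistOn m (F i) G) l (𝓝 0)) {ε : ℝ}
    (hε : 0 < ε) :
    ∀ᶠ i in l, ∃ lam : TimeChange m, lam.logNorm ≤ ENNReal.ofReal ε ∧
      ∀ t : Icc (0 : ℝ≥0) m, dist (F i t) (G (lam t)) ≤ ε ∧
        |((lam t : ℝ≥0) : ℝ) - ((t : ℝ≥0) : ℝ)| ≤ ε := by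
  obtain ⟨δ, hδ, hδε, hmδ⟩ : ∃ δ : ℝ, 0 < δ ∧ δ ≤ ε ∧ m * (Real.exp δ - 1) ≤ ε := by
    have hc : Tendsto (fun δ : ℝ => m * (Real.exp δ - 1)) (𝓝 0) (𝓝 0) := by
      have : Continuous fun δ : ℝ => m * (Real.exp δ - 1) := by fun_prop
      simpa using this.tendsto 0
    have hev : ∀ᶠ δ in 𝓝[>] (0 : ℝ), 0 < δ ∧ δ ≤ ε ∧ m * (Real.exp δ - 1) ≤ ε := by
      filter_upwards [self_mem_nhdsWithin, mem_nhdsWithin_of_mem_nhds (Iic_mem_nhds hε),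
        nhdsWithin_le_nhds (hc.eventually_le_const hε)] with δ h1 h2 h3 using ⟨h1, h2, h3⟩
    exact hev.exists
  filter_upwards [h.eventually_lt_const (ENNReal.ofReal_pos.2 hδ)] with i hi
  obtain ⟨lam, hlam⟩ := iInf_lt_iff.1 hi
  obtain ⟨h1, h2⟩ := max_lt_iff.1 hlam
  refine ⟨lam, h1.le.trans (ENNReal.ofReal_le_ofReal hδε), fun t => ⟨?_, ?_⟩⟩
  · have := (le_iSup (fun t : Icc (0 : ℝ≥0) m => edist (F i t) (G (lam t))) t).trans h2.le
    rw [edist_dist, ENNReal.ofReal_le_ofReal_iff hδ.le] at this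
    exact this.trans hδε
  · exact (lam.abs_apply_sub_le hδ.le h1.le t).trans hmδ

variable [NormedSpace ℝ E]

/-- The weights of the first `M` terms are at most `1`; the remaining terms are bounded by a
geometric tail of total `2⁻¹ ^ M`. -/
theorem skorokhodDist_le_sum_add (M : ℕ) (f g : ℝ≥0 → E) :
    skorokhodDist f g ≤ ∑ k ∈ Finset.range M,
      skorokhodDistOn (k + 1) (cutAt (k + 1) f) (cutAt (k + 1) g) + 2⁻¹ ^ M := by
  unfold skorokhodDist
  rw [← Summable.sum_add_tsum_nat_add' (k := M) ENNReal.summable]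
  refine add_le_add (Finset.sum_le_sum fun k _ => ?_) ?_
  · refine (mul_le_mul' (pow_le_one₀ zero_le ?_) (min_le_right _ _)).trans (one_mul _).le
    simp
  · refine (ENNReal.tsum_le_tsum fun k =>
      (mul_le_mul_right (min_le_left _ _) _).trans (mul_one _).le).trans ?_
    have : ∀ k : ℕ, (2⁻¹ : ℝ≥0∞) ^ (k + M + 1) = 2⁻¹ ^ M * 2⁻¹ ^ (k + 1) := fun k => by ring
    simp_rw [this]
    rw [ENNReal.tsum_mul_left, ENNReal.tsum_geometric_add_one]
    rw [ENNReal.one_sub_inv_two, inv_inv, ENNReal.inv_mul_cancel (by simp) (by simp), mul_one]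

/-- Each weighted term is dominated by the whole series, and truncation at `1` does not matter near
`0`; conversely finitely many terms and a small tail control the series. -/
theorem CadlagPath.tendsto_nhds_iff {ι : Type*} {l : Filter ι} {u : ι → CadlagPath E}
    {f : CadlagPath E} :
    Tendsto u l (𝓝 f) ↔ ∀ k : ℕ, Tendsto (fun i =>
      skorokhodDistOn (k + 1) (cutAt (k + 1) (u i)) (cutAt (k + 1) f)) l (𝓝 0) := by
  rw [tendsto_iff_edist_tendsto_0]
  change Tendsto (fun i => skorokhodDist (u i) f) l (𝓝 0) ↔ _
  constructor
  · intro h k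
    have hpow0 : (2⁻¹ : ℝ≥0∞) ^ (k + 1) ≠ 0 := by simp
    have h1 : Tendsto (fun i => min 1 (skorokhodDistOn (k + 1) (cutAt (k + 1) (u i))
        (cutAt (k + 1) f))) l (𝓝 0) := by
      have h2 : Tendsto (fun i => (2⁻¹ ^ (k + 1))⁻¹ * skorokhodDist (u i) f) l (𝓝 0) := by
        simpa using ENNReal.Tendsto.const_mul h
          (Or.inr (ENNReal.inv_ne_top.2 hpow0))
      refine tendsto_of_tendsto_of_tendsto_of_le_of_le tendsto_const_nhds h2
        (fun _ => zero_le) fun i => ?_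
      have := ENNReal.le_tsum (f := fun k : ℕ => 2⁻¹ ^ (k + 1) *
        min 1 (skorokhodDistOn (k + 1) (cutAt (k + 1) (u i).toFun) (cutAt (k + 1) f.toFun))) k
      rw [mul_comm, ← div_eq_mul_inv, ENNReal.le_div_iff_mul_le (Or.inl hpow0) (Or.inl (by simp)),
        mul_comm]
      exact this
    refine h1.congr' ?_
    filter_upwards [h1.eventually_lt_const one_pos] with i hi
    rcases min_lt_iff.1 hi with h3 | h3
    · exact absurd h3 (lt_irrefl _)
    · exact min_eq_right h3.le
  · intro h
    rw [ENNReal.tendsto_nhds_zero]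
    intro ε hε
    obtain ⟨M, hM⟩ : ∃ M : ℕ, (2⁻¹ : ℝ≥0∞) ^ M < ε / 2 := by
      have := ENNReal.tendsto_pow_atTop_nhds_zero_of_lt_one (r := 2⁻¹) (by simp)
      exact (this.eventually_lt_const (ENNReal.half_pos hε.ne')).exists
    have hs := tendsto_finsetSum (Finset.range M) fun k _ => h k
    rw [Finset.sum_const_zero] at hs
    filter_upwards [hs.eventually_lt_const (ENNReal.half_pos hε.ne')] with i hi
    refine (skorokhodDist_le_sum_add M _ _).trans ?_
    exact (add_le_add hi.le hM.le).trans (ENNReal.add_halves ε).le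

end SkorokhodConvergence

/-! ### Oscillation and discontinuities of càdlàg paths. -/

section JumpPartition

variable {E : Type*} [PseudoMetricSpace E]

/-- Two points near `x` on the same side of it have values near the same one-sided limit; the
excluded case is a pair straddling `x`. -/
theorem IsCadlag.exists_local_oscillation {f : ℝ≥0 → E} (hf : IsCadlag f) {ε : ℝ} (hε : 0 < ε)
    (x : ℝ≥0) :
    ∃ δ > 0, ∀ s ∈ Metric.ball x δ, ∀ t ∈ Metric.ball x δ, s ≤ t → ¬ (s < x ∧ x ≤ t) →
      dist (f s) (f t) ≤ ε := by
  obtain ⟨h1, l, hl⟩ := hf x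
  have e1 := eventually_nhdsWithin_iff.1 (h1.eventually (Metric.ball_mem_nhds _ (half_pos hε)))
  have e2 := eventually_nhdsWithin_iff.1 (hl.eventually (Metric.ball_mem_nhds _ (half_pos hε)))
  obtain ⟨δ, hδ, h⟩ := Metric.eventually_nhds_iff.1 (e1.and e2)
  refine ⟨δ, hδ, fun s hs t ht hst hx => ?_⟩
  rcases le_or_gt x s with hxs | hsx
  · have a := (h hs).1 hxs
    have b := (h ht).1 (hxs.trans hst)
    exact (dist_triangle_right _ _ (f x)).trans (by linarith [Metric.mem_ball.1 a, Metric.mem_ball.1 b])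
  · have htx : t < x := not_le.1 fun h' => hx ⟨hsx, h'⟩
    have a := (h hs).2 hsx
    have b := (h ht).2 htx
    exact (dist_triangle_right _ _ l).trans (by linarith [Metric.mem_ball.1 a, Metric.mem_ball.1 b])

/-- A càdlàg function has, on a bounded interval, a finite partition with small oscillation on each
half-open cell. -/
theorem IsCadlag.exists_partition {f : ℝ≥0 → E} (hf : IsCadlag f) {ε : ℝ} (hε : 0 < ε)
    (T : ℝ≥0) :
    ∃ S : Finset ℝ≥0, ∀ s t, s ≤ t → t ≤ T → (∀ x ∈ S, ¬ (s < x ∧ x ≤ t)) →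
      dist (f s) (f t) ≤ ε := by
  choose δ hδ h using hf.exists_local_oscillation hε
  obtain ⟨J, -, hJ⟩ := (isCompact_Icc (a := (0 : ℝ≥0)) (b := T)).elim_nhds_subcover
    (fun x => Metric.ball x (δ x)) fun x _ => Metric.ball_mem_nhds x (hδ x)
  obtain ⟨ρ, hρ, hρJ⟩ := lebesgue_number_lemma_of_metric (isCompact_Icc (a := (0 : ℝ≥0)) (b := T))
    (c := fun x : J => Metric.ball (x : ℝ≥0) (δ x)) (fun x => Metric.isOpen_ball)
    (hJ.trans (by intro y; simp))
  classical
  set η : ℝ≥0 := ρ.toNNReal with hη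
  have hη0 : 0 < η := Real.toNNReal_pos.2 hρ
  -- The multiples of `η` keep unseparated `s` and `t` within the Lebesgue number `ρ`, hence in one
  -- ball of the cover; the centres in `J` then rule out straddling the centre of that ball.
  refine ⟨J ∪ (Finset.range (⌊T / η⌋₊ + 1)).image fun k : ℕ => (k : ℝ≥0) * η,
    fun s t hst htT hS => ?_⟩
  have hk : (⌊t / η⌋₊ : ℝ≥0) * η ≤ t := by
    rw [← le_div_iff₀ hη0]; exact Nat.floor_le zero_le
  have hk' : t < (⌊t / η⌋₊ + 1 : ℝ≥0) * η := by
    rw [← div_lt_iff₀ hη0]; exact Nat.lt_floor_add_one _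
  have hks : (⌊t / η⌋₊ : ℝ≥0) * η ≤ s := by
    by_contra hcon
    refine hS _ (Finset.mem_union_right _ (Finset.mem_image.2 ⟨⌊t / η⌋₊, ?_, rfl⟩))
      ⟨not_le.1 hcon, hk⟩
    rw [Finset.mem_range, Nat.lt_succ_iff]
    exact Nat.floor_mono (div_le_div_of_nonneg_right htT zero_le)
  have hts : dist s t < ρ := by
    have h3 : t < s + η := hk'.trans_le (by rw [add_mul, one_mul]; gcongr)
    have h4 : (t : ℝ) < s + ρ := by
      have : (t : ℝ) < ((s + η : ℝ≥0) : ℝ) := by exact_mod_cast h3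
      rwa [NNReal.coe_add, hη, Real.coe_toNNReal _ hρ.le] at this
    have h5 : (s : ℝ) ≤ t := by exact_mod_cast hst
    rw [NNReal.dist_eq, abs_lt]
    constructor <;> linarith
  obtain ⟨x, hx⟩ := hρJ s ⟨zero_le, hst.trans htT⟩
  refine h x s (hx (Metric.mem_ball_self hρ)) t (hx ?_) hst
    (hS x (Finset.mem_union_left _ x.2))
  rwa [Metric.mem_ball, dist_comm]

/-- Every discontinuity lies in one of the finite partitions for precision `1 / (n + 1)` on `[0,
n]`: near a point outside `S n`, no element of `S n` separates it from its neighbours. -/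
theorem IsCadlag.countable_not_continuousAt {f : ℝ≥0 → E} (hf : IsCadlag f) :
    {x | ¬ ContinuousAt f x}.Countable := by
  choose S hS using fun n : ℕ => hf.exists_partition (ε := 1 / ((n : ℝ) + 1)) (by positivity) n
  refine (Set.countable_iUnion fun n => (S n).countable_toSet).mono fun x hx => ?_
  by_contra hcon
  refine hx (Metric.tendsto_nhds.2 fun ε hε => ?_)
  obtain ⟨n, hn, hxn⟩ : ∃ n : ℕ, 1 / ((n : ℝ) + 1) < ε ∧ x < n := by
    have h1 := (tendsto_one_div_add_atTop_nhds_zero_nat (𝕜 := ℝ)).eventually_lt_const hε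
    have h2 := (tendsto_natCast_atTop_atTop (R := ℝ≥0)).eventually_gt_atTop x
    exact (h1.and h2).exists
  have hxS : x ∉ S n := fun h => hcon (mem_iUnion.2 ⟨n, h⟩)
  have hopen : ∀ᶠ s in 𝓝 x, ∀ y ∈ S n, (x < y → s < y) ∧ (y < x → y < s) := by
    rw [Filter.eventually_all_finset]
    intro y hy
    rcases lt_or_gt_of_ne (fun h : x = y => hxS (h ▸ hy)) with h | h
    · filter_upwards [Iio_mem_nhds h] with s hs using ⟨fun _ => hs, fun h' => absurd h h'.not_gt⟩
    · filter_upwards [Ioi_mem_nhds h] with s hs using ⟨fun h' => absurd h h'.not_gt, fun _ => hs⟩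
  filter_upwards [hopen, Iio_mem_nhds hxn] with s hs hsn
  refine lt_of_le_of_lt ?_ hn
  rcases le_total s x with hsx | hsx
  · refine hS n s x hsx hxn.le fun y hy hy' => ?_
    rcases hy'.2.eq_or_lt with rfl | h
    · exact hxS hy
    · exact absurd ((hs y hy).2 h) hy'.1.not_gt
  · rw [dist_comm]
    exact hS n x s hsx hsn.le fun y hy hy' => absurd ((hs y hy).1 hy'.1) hy'.2.not_gt

end JumpPartition

/-! ### The cut-off `f^{(m)}`. -/

section Cut

variable {E : Type*} [NormedAddCommGroup E] [NormedSpace ℝ E]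

theorem cutAt_of_add_one_le {m : ℕ} (f : ℝ≥0 → E) {t : ℝ≥0} (h : t + 1 ≤ m) :
    cutAt m f t = f t := by
  have h' : (t : ℝ) + 1 ≤ m := by exact_mod_cast h
  rw [cutAt, min_eq_left (by linarith), max_eq_left zero_le_one, one_smul]

theorem cutAt_factor_mem (m : ℕ) (t : ℝ≥0) :
    0 ≤ max (min 1 ((m : ℝ) - (t : ℝ))) 0 ∧ max (min 1 ((m : ℝ) - (t : ℝ))) 0 ≤ 1 :=
  ⟨le_max_right _ _, max_le (min_le_left _ _) zero_le_one⟩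

theorem norm_cutAt_le (m : ℕ) (f : ℝ≥0 → E) (t : ℝ≥0) : ‖cutAt m f t‖ ≤ ‖f t‖ := by
  obtain ⟨h0, h1⟩ := cutAt_factor_mem m t
  rw [cutAt, norm_smul, Real.norm_of_nonneg h0]
  exact mul_le_of_le_one_left (norm_nonneg _) h1

theorem dist_cutAt_le (m : ℕ) (f g : ℝ≥0 → E) (t : ℝ≥0) :
    dist (cutAt m f t) (cutAt m g t) ≤ dist (f t) (g t) := by
  have := norm_cutAt_le m (fun s => f s - g s) t
  simpa only [cutAt, dist_eq_norm, smul_sub] using this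

/-- The cut-off factor is `1`-Lipschitz in time with values in `[0, 1]`, so shifting time costs at
most the shift times the norm of the value. -/
theorem dist_cutAt_cutAt_le (m : ℕ) (f g : ℝ≥0 → E) (s t : ℝ≥0) :
    dist (cutAt m f s) (cutAt m g t) ≤ dist (f s) (g t) + |(s : ℝ) - t| * ‖g t‖ := by
  obtain ⟨h0, h1⟩ := cutAt_factor_mem m s
  have hc : |max (min 1 ((m : ℝ) - (s : ℝ))) 0 - max (min 1 ((m : ℝ) - (t : ℝ))) 0|
      ≤ |(s : ℝ) - t| := by
    refine (abs_max_sub_max_le_abs _ _ _).trans ?_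
    rw [min_comm 1, min_comm 1]
    refine (abs_min_sub_min_le_max _ _ _ _).trans (max_le ?_ (by simp))
    rw [abs_sub_comm]; exact le_of_eq (by ring_nf)
  have hd : cutAt m f s - cutAt m g t = max (min 1 ((m : ℝ) - (s : ℝ))) 0 • (f s - g t) +
      (max (min 1 ((m : ℝ) - (s : ℝ))) 0 - max (min 1 ((m : ℝ) - (t : ℝ))) 0) • g t := by
    simp only [cutAt]; module
  rw [dist_eq_norm, dist_eq_norm, hd]
  refine (norm_add_le _ _).trans (add_le_add ?_ ?_)
  · rw [norm_smul, Real.norm_of_nonneg h0]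
    exact mul_le_of_le_one_left (norm_nonneg _) h1
  · rw [norm_smul]
    exact mul_le_mul_of_nonneg_right hc (norm_nonneg _)

theorem continuous_cutAt_factor (m : ℕ) :
    Continuous fun t : ℝ≥0 => max (min 1 ((m : ℝ) - (t : ℝ))) 0 := by fun_prop

end Cut

/-! ### Values and integrals along a `J₁`-convergent family. -/

section LimitsAlongPaths

variable {E : Type*} [NormedAddCommGroup E] [NormedSpace ℝ E]
  {ι : Type*} {l : Filter ι} {u : ι → CadlagPath E} {f : CadlagPath E}

/-- The time change displaces `t` only slightly, which continuity of the limit at `t` absorbs. The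
horizon `k + 1` exceeds `t + 1`, so the cut-off is inactive at `t`. -/
theorem CadlagPath.tendsto_apply (h : Tendsto u l (𝓝 f)) {t : ℝ≥0}
    (ht : ContinuousAt f.toFun t) : Tendsto (fun i => u i t) l (𝓝 (f t)) := by
  obtain ⟨k, hk⟩ := exists_nat_gt (t + 1)
  have htk : t < k := lt_of_le_of_lt le_self_add hk
  have hcut : ContinuousAt (cutAt (k + 1) f) t := (continuous_cutAt_factor _).continuousAt.smul ht
  have hval : ∀ g : ℝ≥0 → E, cutAt (k + 1) g t = g t := fun g =>
    cutAt_of_add_one_le g (by push_cast; gcongr)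
  refine Metric.tendsto_nhds.2 fun ε hε => ?_
  obtain ⟨δ, hδ, hδc⟩ := Metric.continuousAt_iff.1 hcut (ε / 2) (half_pos hε)
  filter_upwards [exists_timeChange_of_tendsto (CadlagPath.tendsto_nhds_iff.1 h k)
    (lt_min (half_pos hδ) (by positivity : 0 < ε / 4))] with i ⟨lam, _, hlam⟩
  obtain ⟨h1, h2⟩ := hlam ⟨t, zero_le, by push_cast; exact htk.le.trans le_self_add⟩
  have h3 := hδc (x := (lam ⟨t, zero_le, by push_cast; exact htk.le.trans le_self_add⟩ : ℝ≥0))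
    (by rw [NNReal.dist_eq]; linarith [h2.trans (min_le_left _ _)])
  rw [hval] at h1 h3
  have h4 := h1.trans (min_le_right _ _)
  exact (dist_triangle _ _ _).trans_lt (by linarith)

theorem CadlagPath.eventually_bounded (h : Tendsto u l (𝓝 f)) (T : ℝ≥0) :
    ∃ C : ℝ, ∀ᶠ i in l, ∀ t ≤ T, ‖u i t‖ ≤ C := by
  obtain ⟨k, hk⟩ := exists_nat_ge T
  obtain ⟨C, hC⟩ := f.isCadlag'.exists_bound (k + 1 : ℕ)
  refine ⟨C + 1, ?_⟩
  filter_upwards [exists_timeChange_of_tendsto (CadlagPath.tendsto_nhds_iff.1 h k) one_pos] with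
    i ⟨lam, _, hlam⟩ t ht
  have htk : t + 1 ≤ (k + 1 : ℕ) := by push_cast; gcongr; exact ht.trans hk
  have h1 := (hlam ⟨t, zero_le, le_self_add.trans htk⟩).1
  rw [cutAt_of_add_one_le _ htk] at h1
  have h2 := (norm_cutAt_le (k + 1) f _).trans (hC _ (lam ⟨t, zero_le, le_self_add.trans htk⟩).2)
  have h3 := norm_le_norm_add_norm_sub' (u i t)
    (cutAt (k + 1) f (lam ⟨t, zero_le, le_self_add.trans htk⟩))
  rw [dist_eq_norm] at h1
  linarith

/-- Dominated convergence: the integrand tends to `0` off the countable set of discontinuities of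
`f`, and local bounds dominate it. -/
theorem CadlagPath.tendsto_integral_norm_sub [l.IsCountablyGenerated] (h : Tendsto u l (𝓝 f))
    (T : ℝ≥0) :
    Tendsto (fun i => ∫ s in (0 : ℝ)..T, ‖u i s.toNNReal - f s.toNNReal‖) l (𝓝 0) := by
  obtain ⟨C, hC⟩ := CadlagPath.eventually_bounded h T
  obtain ⟨D, hD⟩ := f.isCadlag'.exists_bound T
  have key := intervalIntegral.tendsto_integral_filter_of_dominated_convergence (l := l)
    (μ := volume) (a := (0 : ℝ)) (b := T) (f := fun _ => (0 : ℝ))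
    (F := fun i (s : ℝ) => ‖u i s.toNNReal - f s.toNNReal‖) (fun _ => C + D) ?_ ?_ ?_ ?_
  · simpa using key
  · refine Eventually.of_forall fun i => ?_
    exact ((((u i).isCadlag'.stronglyMeasurable.sub f.isCadlag'.stronglyMeasurable).comp_measurable
      measurable_real_toNNReal).norm).aestronglyMeasurable
  · filter_upwards [hC] with i hi
    refine Eventually.of_forall fun s hs => ?_
    rw [uIoc_of_le T.coe_nonneg] at hs
    have hs' : s.toNNReal ≤ T := Real.toNNReal_le_iff_le_coe.2 hs.2
    rw [norm_norm]
    exact (norm_sub_le _ _).trans (add_le_add (hi _ hs') (hD _ ⟨zero_le, hs'⟩))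
  · exact intervalIntegrable_const
  · have hcount : ((fun x : ℝ≥0 => (x : ℝ)) '' {x | ¬ ContinuousAt f.toFun x}).Countable :=
      f.isCadlag'.countable_not_continuousAt.image _
    filter_upwards [compl_mem_ae_iff.2 (hcount.measure_zero volume)] with s hs hsT
    rw [uIoc_of_le T.coe_nonneg] at hsT
    have hcont : ContinuousAt f.toFun s.toNNReal := by
      by_contra hcon
      exact hs ⟨_, hcon, Real.coe_toNNReal _ hsT.1.le⟩
    exact tendsto_iff_norm_sub_tendsto_zero.1 (CadlagPath.tendsto_apply h hcont)

theorem norm_primitive_sub_le {f g : ℝ≥0 → E} (hf : IsCadlag f) (hg : IsCadlag g) {s T : ℝ≥0}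
    (hs : s ≤ T) :
    ‖primitive f s - primitive g s‖ ≤ ∫ r in (0 : ℝ)..T, ‖f r.toNNReal - g r.toNNReal‖ := by
  rw [primitive, primitive,
    ← intervalIntegral.integral_sub (hf.intervalIntegrable _ _) (hg.intervalIntegrable _ _)]
  refine (intervalIntegral.norm_integral_le_integral_norm s.2).trans ?_
  refine intervalIntegral.integral_mono_interval le_rfl s.2 (by exact_mod_cast hs)
    (Eventually.of_forall fun _ => norm_nonneg _) ?_
  exact ((hf.intervalIntegrable _ _).sub (hg.intervalIntegrable _ _)).norm

theorem norm_primitive_sub_le_mul {f g : ℝ≥0 → E} (hf : IsCadlag f) (hg : IsCadlag g)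
    {s : ℝ≥0} {C : ℝ} (h : ∀ r ≤ s, ‖f r - g r‖ ≤ C) :
    ‖primitive f s - primitive g s‖ ≤ C * s := by
  rw [primitive, primitive,
    ← intervalIntegral.integral_sub (hf.intervalIntegrable _ _) (hg.intervalIntegrable _ _)]
  refine (intervalIntegral.norm_integral_le_of_norm_le_const (C := C) fun r hr => ?_).trans ?_
  · rw [uIoc_of_le s.coe_nonneg] at hr
    exact h _ (Real.toNNReal_le_iff_le_coe.2 hr.2)
  · rw [sub_zero, abs_of_nonneg s.coe_nonneg]

theorem norm_primitive_sub_primitive_le {f : ℝ≥0 → E} (hf : IsCadlag f) {s t : ℝ≥0} (hst : s ≤ t)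
    {C : ℝ} (h : ∀ r ≤ t, ‖f r‖ ≤ C) :
    ‖primitive f s - primitive f t‖ ≤ C * (t - s) := by
  rw [primitive, primitive, norm_sub_rev, intervalIntegral.integral_interval_sub_left
    (hf.intervalIntegrable _ _) (hf.intervalIntegrable _ _)]
  have hst' : (s : ℝ) ≤ t := by exact_mod_cast hst
  refine (intervalIntegral.norm_integral_le_of_norm_le_const (C := C) fun r hr => ?_).trans ?_
  · rw [uIoc_of_le hst'] at hr
    exact h _ (Real.toNNReal_le_iff_le_coe.2 hr.2)
  · rw [abs_of_nonneg (by linarith)]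

theorem CadlagPath.tendstoUniformlyOn_primitive [l.IsCountablyGenerated] (h : Tendsto u l (𝓝 f))
    (T : ℝ≥0) :
    TendstoUniformlyOn (fun i => primitive (u i)) (primitive f) l (Iic T) := by
  rw [Metric.tendstoUniformlyOn_iff]
  intro ε hε
  filter_upwards [(CadlagPath.tendsto_integral_norm_sub h T).eventually_lt_const hε] with i hi s hs
  rw [dist_comm, dist_eq_norm]
  exact (norm_primitive_sub_le (u i).isCadlag' f.isCadlag' hs).trans_lt hi

theorem tendstoUniformlyOn_primitive {G : ι → ℝ≥0 → E} {H : ℝ≥0 → E} (hG : ∀ i, IsCadlag (G i))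
    (hH : IsCadlag H) {T : ℝ≥0} (h : TendstoUniformlyOn G H l (Iic T)) :
    TendstoUniformlyOn (fun i => primitive (G i)) (primitive H) l (Iic T) := by
  rw [Metric.tendstoUniformlyOn_iff] at h ⊢
  intro ε hε
  filter_upwards [h (ε / (T + 1)) (by positivity)] with i hi s hs
  rw [dist_comm, dist_eq_norm]
  refine (norm_primitive_sub_le_mul (hG i) hH (C := ε / (T + 1)) fun r hr => ?_).trans_lt ?_
  · rw [← dist_eq_norm, dist_comm]
    exact (hi r (hr.trans hs)).le
  · have hs' : (s : ℝ) ≤ T := by exact_mod_cast hs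
    rw [div_mul_eq_mul_div, div_lt_iff₀ (by positivity)]
    exact mul_lt_mul_of_pos_left (by linarith) hε

/-- Uniform continuity of the cut limit gives one `δ` for all indices, so any time change that moves
points by at most `δ` is admissible. This permits reusing a time change chosen for another path. -/
theorem eventually_dist_cutAt_le {m : ℕ} {G : ι → ℝ≥0 → E} {H : ℝ≥0 → E} (hH : Continuous H)
    (h : TendstoUniformlyOn G H l (Iic (m : ℝ≥0))) {ε : ℝ} (hε : 0 < ε) :
    ∃ δ > 0, ∀ᶠ i in l, ∀ t ≤ (m : ℝ≥0), ∀ s ≤ (m : ℝ≥0), |(s : ℝ) - t| ≤ δ →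
      dist (cutAt m (G i) t) (cutAt m H s) ≤ ε := by
  have hcont : Continuous (cutAt m H) := (continuous_cutAt_factor m).smul hH
  have huc := (isCompact_Icc (a := (0 : ℝ≥0)) (b := m)).uniformContinuousOn_of_continuous
    hcont.continuousOn
  obtain ⟨δ, hδ, hu⟩ := Metric.uniformContinuousOn_iff.1 huc (ε / 2) (half_pos hε)
  refine ⟨δ / 2, half_pos hδ, ?_⟩
  filter_upwards [Metric.tendstoUniformlyOn_iff.1 h (ε / 2) (half_pos hε)] with i hi t ht s hs hst
  have h1 := hu t ⟨zero_le, ht⟩ s ⟨zero_le, hs⟩ (by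
    rw [dist_comm, NNReal.dist_eq]; linarith)
  have h2 := (dist_cutAt_le m (G i) H t).trans_lt ((dist_comm _ _).trans_lt (hi t ht))
  exact (dist_triangle _ _ _).trans (by linarith)

end LimitsAlongPaths

/-! ### From uniform convergence on compacts to `J₁` convergence. -/

section UniformConvergence

variable {E : Type*} [NormedAddCommGroup E] [NormedSpace ℝ E]

theorem skorokhodDistOn_cutAt_le {m : ℕ} {f g : ℝ≥0 → E} {C : ℝ}
    (h : ∀ t ≤ (m : ℝ≥0), dist (f t) (g t) ≤ C) :
    skorokhodDistOn m (cutAt m f) (cutAt m g) ≤ ENNReal.ofReal C := by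
  refine iInf_le_of_le (OrderIso.refl _) (max_le ?_ (iSup_le fun t => ?_))
  · rw [TimeChange.logNorm_refl]; exact zero_le
  · rw [edist_dist]
    exact ENNReal.ofReal_le_ofReal ((dist_cutAt_le m f g t).trans (h t t.2.2))

theorem CadlagPath.tendsto_of_tendstoUniformlyOn {ι : Type*} {l : Filter ι}
    {u : ι → CadlagPath E} {f : CadlagPath E}
    (h : ∀ T : ℝ≥0, TendstoUniformlyOn (fun i => (u i).toFun) f.toFun l (Iic T)) :
    Tendsto u l (𝓝 f) := by
  refine CadlagPath.tendsto_nhds_iff.2 fun k => tendsto_skorokhodDistOn_zero fun ε hε => ?_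
  filter_upwards [Metric.tendstoUniformlyOn_iff.1 (h (k + 1 : ℕ)) ε hε] with i hi
  refine ⟨OrderIso.refl _, by rw [TimeChange.logNorm_refl]; exact zero_le, fun t => ?_⟩
  refine (dist_cutAt_le _ _ _ _).trans ?_
  rw [dist_comm]
  exact (hi t t.2.2).le

end UniformConvergence

/-! ### Stacked paths and continuity of `Φ`. -/

section Stack

variable {d : ℕ}

theorem norm_stack_le (x y z : EuclideanSpace ℝ (Fin d)) :
    ‖stack x y z‖ ≤ ‖x‖ + ‖y‖ + ‖z‖ := by
  have h : ‖stack x y z‖ ^ 2 = ‖x‖ ^ 2 + ‖y‖ ^ 2 + ‖z‖ ^ 2 := by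
    simp only [EuclideanSpace.norm_sq_eq, stack]
    rw [Equiv.sum_comp finProdFinEquiv.symm
      (fun q : Fin 3 × Fin d => ‖(![x, y, z] q.1) q.2‖ ^ 2), Fintype.sum_prod_type,
      Fin.sum_univ_three]
    rfl
  refine (sq_le_sq₀ (norm_nonneg _) (by positivity)).1 ?_
  rw [h]
  nlinarith [norm_nonneg x, norm_nonneg y, norm_nonneg z, mul_nonneg (norm_nonneg x) (norm_nonneg y),
    mul_nonneg (norm_nonneg x) (norm_nonneg z), mul_nonneg (norm_nonneg y) (norm_nonneg z)]

theorem stack_sub (x y z x' y' z' : EuclideanSpace ℝ (Fin d)) :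
    stack x y z - stack x' y' z' = stack (x - x') (y - y') (z - z') := by
  ext k
  simp only [stack, PiLp.sub_apply]
  generalize finProdFinEquiv.symm k = q
  obtain ⟨i, j⟩ := q
  fin_cases i <;> simp

theorem smul_stack (c : ℝ) (x y z : EuclideanSpace ℝ (Fin d)) :
    c • stack x y z = stack (c • x) (c • y) (c • z) := by
  ext k
  simp only [stack, PiLp.smul_apply]
  generalize finProdFinEquiv.symm k = q
  obtain ⟨i, j⟩ := q
  fin_cases i <;> simp

theorem dist_stack_le (x y z x' y' z' : EuclideanSpace ℝ (Fin d)) :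
    dist (stack x y z) (stack x' y' z') ≤ dist x x' + dist y y' + dist z z' := by
  simpa only [dist_eq_norm, stack_sub] using norm_stack_le (x - x') (y - y') (z - z')

/-- `J₁` convergence does not pass to products in general, since the blocks may need different time
changes. Here the last two blocks converge uniformly to continuous limits and tolerate the time
change of the first. -/
theorem CadlagPath.tendsto_stack {ι : Type*} {l : Filter ι}
    {u : ι → CadlagPath (EuclideanSpace ℝ (Fin d))} {f : CadlagPath (EuclideanSpace ℝ (Fin d))}
    {w : ι → CadlagPath (EuclideanSpace ℝ (Fin (3 * d)))}
    {v : CadlagPath (EuclideanSpace ℝ (Fin (3 * d)))}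
    {G H : ι → ℝ≥0 → EuclideanSpace ℝ (Fin d)} {G₀ H₀ : ℝ≥0 → EuclideanSpace ℝ (Fin d)}
    (hw : ∀ i t, w i t = stack (u i t) (G i t) (H i t)) (hv : ∀ t, v t = stack (f t) (G₀ t) (H₀ t))
    (hG₀ : Continuous G₀) (hH₀ : Continuous H₀)
    (hG : ∀ T : ℝ≥0, TendstoUniformlyOn G G₀ l (Iic T))
    (hH : ∀ T : ℝ≥0, TendstoUniformlyOn H H₀ l (Iic T)) (hu : Tendsto u l (𝓝 f)) :
    Tendsto w l (𝓝 v) := by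
  refine CadlagPath.tendsto_nhds_iff.2 fun k => tendsto_skorokhodDistOn_zero fun ε hε => ?_
  have hε3 : 0 < ε / 3 := by positivity
  obtain ⟨δ₁, hδ₁, h₁⟩ := eventually_dist_cutAt_le hG₀ (hG (k + 1 : ℕ)) hε3
  obtain ⟨δ₂, hδ₂, h₂⟩ := eventually_dist_cutAt_le hH₀ (hH (k + 1 : ℕ)) hε3
  filter_upwards [exists_timeChange_of_tendsto (CadlagPath.tendsto_nhds_iff.1 hu k)
    (lt_min hε3 (lt_min hδ₁ hδ₂)), h₁, h₂] with i ⟨lam, hlam, hd⟩ hi₁ hi₂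
  refine ⟨lam, hlam.trans (ENNReal.ofReal_le_ofReal ((min_le_left _ _).trans (by linarith))),
    fun t => ?_⟩
  obtain ⟨ha, hb⟩ := hd t
  have e₁ := hi₁ t t.2.2 (lam t) (lam t).2.2
    (hb.trans ((min_le_right _ _).trans (min_le_left _ _)))
  have e₂ := hi₂ t t.2.2 (lam t) (lam t).2.2
    (hb.trans ((min_le_right _ _).trans (min_le_right _ _)))
  have e₀ := ha.trans (min_le_left _ _)
  have hcw : cutAt (k + 1) (w i) t =
      stack (cutAt (k + 1) (u i) t) (cutAt (k + 1) (G i) t) (cutAt (k + 1) (H i) t) := by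
    simp only [cutAt, hw, smul_stack]
  have hcv : cutAt (k + 1) v (lam t) =
      stack (cutAt (k + 1) f (lam t)) (cutAt (k + 1) G₀ (lam t)) (cutAt (k + 1) H₀ (lam t)) := by
    simp only [cutAt, hv, smul_stack]
  rw [hcw, hcv]
  exact (dist_stack_le _ _ _ _ _ _).trans (by linarith)

theorem continuous_iteratedIntegralMap :
    Continuous (iteratedIntegralMap (d := d)) := by
  refine continuous_iff_continuousAt.2 fun f => ?_
  have hG := CadlagPath.tendstoUniformlyOn_primitive (tendsto_id (x := 𝓝 f))
  exact CadlagPath.tendsto_stack (u := id) (f := f) (fun _ _ => rfl) (fun _ => rfl)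
    f.isCadlag'.continuous_primitive f.isCadlag'.continuous_primitive.isCadlag.continuous_primitive
    hG (fun T => tendstoUniformlyOn_primitive
      (fun g : CadlagPath (EuclideanSpace ℝ (Fin d)) => g.isCadlag'.continuous_primitive.isCadlag)
      f.isCadlag'.continuous_primitive.isCadlag (hG T)) tendsto_id

end Stack

/-! ### Time changes adapted to the grid, and step approximation of paths. -/

section GridApproximation

/-- The map `x + ψ x` has difference quotients within `K` of `1`, hence is strictly increasing; it
fixes `0` and `m`, so it is onto by the intermediate value theorem. -/
theorem exists_timeChange_of_lipschitz {m : ℕ} {ψ : ℝ → ℝ} {K : ℝ≥0} (hK : (K : ℝ) ≤ 1 / 2)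
    (hψ : LipschitzWith K ψ) (h0 : ψ 0 = 0) (hm : ψ m = 0) :
    ∃ lam : TimeChange m, lam.logNorm ≤ ENNReal.ofReal (2 * K) ∧
      ∀ t : Icc (0 : ℝ≥0) m, ((lam t : ℝ≥0) : ℝ) = ((t : ℝ≥0) : ℝ) + ψ t := by
  have hlip : ∀ x y : ℝ, x ≤ y → |ψ y - ψ x| ≤ K * (y - x) := fun x y hxy => by
    have := hψ.dist_le_mul y x
    rwa [Real.dist_eq, Real.dist_eq, abs_of_nonneg (sub_nonneg.2 hxy)] at this
  have hmono : StrictMono fun x : ℝ => x + ψ x := fun x y hxy => by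
    have h1 := (abs_le.1 (hlip x y hxy.le)).1
    show x + ψ x < y + ψ y
    nlinarith
  have hcont : Continuous fun x : ℝ => x + ψ x := continuous_id.add hψ.continuous
  have hlow : ∀ t : Icc (0 : ℝ≥0) m, 0 ≤ ((t : ℝ≥0) : ℝ) + ψ t := fun t => by
    have := hmono.monotone (t : ℝ≥0).coe_nonneg
    simpa [h0] using this
  have hup : ∀ t : Icc (0 : ℝ≥0) m, ((t : ℝ≥0) : ℝ) + ψ t ≤ m := fun t => by
    have : ((t : ℝ≥0) : ℝ) ≤ m := by exact_mod_cast t.2.2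
    simpa [hm] using hmono.monotone this
  let φ : Icc (0 : ℝ≥0) m → Icc (0 : ℝ≥0) m := fun t =>
    ⟨⟨_, hlow t⟩, zero_le, by exact_mod_cast hup t⟩
  have hφ : ∀ t, ((φ t : ℝ≥0) : ℝ) = ((t : ℝ≥0) : ℝ) + ψ t := fun t => rfl
  have hφmono : StrictMono φ := fun s t hst => by
    have : ((s : ℝ≥0) : ℝ) < ((t : ℝ≥0) : ℝ) := by exact_mod_cast hst
    have := hmono this
    exact Subtype.coe_lt_coe.1 (NNReal.coe_lt_coe.1 this)
  have hφsurj : Function.Surjective φ := fun y => by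
    have hy : ((y : ℝ≥0) : ℝ) ∈ Icc ((0 : ℝ) + ψ 0) ((m : ℝ) + ψ m) := by
      rw [h0, hm, add_zero, add_zero]
      exact ⟨(y : ℝ≥0).coe_nonneg, by exact_mod_cast y.2.2⟩
    obtain ⟨x, hx, hxy⟩ := intermediate_value_Icc (Nat.cast_nonneg m) hcont.continuousOn hy
    refine ⟨⟨⟨x, hx.1⟩, zero_le, by exact_mod_cast hx.2⟩, ?_⟩
    exact Subtype.ext (NNReal.coe_injective hxy)
  refine ⟨hφmono.orderIsoOfSurjective φ hφsurj, ?_, hφ⟩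
  refine iSup_le fun s => iSup_le fun t => iSup_le fun hst => ENNReal.ofReal_le_ofReal ?_
  rw [StrictMono.coe_orderIsoOfSurjective, hφ, hφ]
  have hst' : ((s : ℝ≥0) : ℝ) < ((t : ℝ≥0) : ℝ) := by exact_mod_cast hst
  obtain ⟨h1, h2⟩ := abs_le.1 (hlip _ _ hst'.le)
  set a : ℝ := ((s : ℝ≥0) : ℝ)
  set b : ℝ := ((t : ℝ≥0) : ℝ)
  have hab : 0 < b - a := sub_pos.2 hst'
  set r := (b + ψ b - (a + ψ a)) / (b - a) with hr
  have hr1 : r ≤ 1 + K := by rw [hr, div_le_iff₀ hab]; linarith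
  have hr2 : 1 - K ≤ r := by rw [hr, le_div_iff₀ hab]; linarith
  have hr0 : 0 < r := by linarith
  have hK0 : (0 : ℝ) ≤ K := K.coe_nonneg
  have hlog1 := Real.log_le_sub_one_of_pos hr0
  have hlog2 := Real.one_sub_inv_le_log_of_pos hr0
  -- Uses `(1 - K) * (1 + 2 * K) ≥ 1`, valid for `0 ≤ K ≤ 1 / 2`.
  have hinv : r⁻¹ ≤ 1 + 2 * K := by
    rw [inv_le_iff_one_le_mul₀ hr0]
    nlinarith
  rw [abs_le]
  constructor <;> linarith

theorem gridFloor_le {n : ℕ} (t : ℝ≥0) : gridFloor n t ≤ t := by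
  rcases Nat.eq_zero_or_pos n with rfl | hn
  · simp [gridFloor]
  · have hn' : (0 : ℝ≥0) < n := by exact_mod_cast hn
    rw [gridFloor, div_le_iff₀ hn', mul_comm]
    exact Nat.floor_le zero_le

theorem le_gridFloor_add {n : ℕ} (hn : 0 < n) (t : ℝ≥0) : (t : ℝ) ≤ gridFloor n t + 1 / n := by
  have hn' : (0 : ℝ≥0) < n := by exact_mod_cast hn
  have : t ≤ gridFloor n t + 1 / n := by
    rw [gridFloor, ← add_div, le_div_iff₀ hn', mul_comm]
    exact (Nat.lt_floor_add_one _).le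
  exact_mod_cast this

/-- `⌈n t⌉ / n`. -/
def gridCeil (n : ℕ) (t : ℝ≥0) : ℝ≥0 := (⌈(n : ℝ≥0) * t⌉₊ : ℝ≥0) / (n : ℝ≥0)

/-- A Galois connection: a path sampled on the grid sees a jump at `s` from time `gridCeil n s` on.
-/
theorem gridCeil_le_iff {n : ℕ} (hn : 0 < n) {s t : ℝ≥0} :
    gridCeil n s ≤ t ↔ s ≤ gridFloor n t := by
  have hn' : (0 : ℝ≥0) < n := by exact_mod_cast hn
  rw [gridCeil, gridFloor, div_le_iff₀ hn', le_div_iff₀ hn', mul_comm t, mul_comm s,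
    ← Nat.le_floor_iff zero_le, Nat.ceil_le]

theorem gridCeil_natCast {n : ℕ} (hn : 0 < n) (m : ℕ) : gridCeil n m = m := by
  have hn' : (n : ℝ≥0) ≠ 0 := by exact_mod_cast hn.ne'
  rw [gridCeil, ← Nat.cast_mul, Nat.ceil_natCast, Nat.cast_mul, mul_div_cancel_left₀ _ hn']

theorem le_gridCeil {n : ℕ} (hn : 0 < n) (t : ℝ≥0) : t ≤ gridCeil n t := by
  have hn' : (0 : ℝ≥0) < n := by exact_mod_cast hn
  rw [gridCeil, le_div_iff₀ hn', mul_comm]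
  exact Nat.le_ceil _

theorem gridCeil_le_add {n : ℕ} (hn : 0 < n) (t : ℝ≥0) : gridCeil n t ≤ t + 1 / n := by
  have hn' : (0 : ℝ≥0) < n := by exact_mod_cast hn
  rw [gridCeil, div_le_iff₀ hn', add_mul, one_div_mul_cancel hn'.ne', mul_comm t]
  exact (Nat.ceil_lt_add_one zero_le).le

theorem Finset.exists_pos_le_dist {X : Type*} [MetricSpace X] (P : Finset X) :
    ∃ δ > 0, ∀ p ∈ P, ∀ q ∈ P, p ≠ q → δ ≤ dist p q := by
  have h : ∀ᶠ δ in 𝓝[>] (0 : ℝ), 0 < δ ∧ ∀ p ∈ P, ∀ q ∈ P, p ≠ q → δ ≤ dist p q := by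
    refine (eventually_mem_nhdsWithin).and ?_
    rw [Filter.eventually_all_finset]
    intro p _
    rw [Filter.eventually_all_finset]
    intro q _
    by_cases hpq : p = q
    · exact Eventually.of_forall fun _ h => absurd hpq h
    · filter_upwards [nhdsWithin_le_nhds (Iic_mem_nhds (dist_pos.2 hpq))] with δ hδ _ using hδ
  obtain ⟨δ, h1, h2⟩ := h.exists
  exact ⟨δ, h1, h2⟩

/-- A time change close to the identity can send the grid points `⌈n p⌉ / n` to `p`, for all `p` in
a given finite set. -/
theorem exists_timeChange_gridCeil {m : ℕ} (P : Finset ℝ≥0) (hP : ∀ p ∈ P, p ≤ m)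
    {K : ℝ≥0} (hK0 : 0 < K) (hK : (K : ℝ) ≤ 1 / 2) :
    ∀ᶠ n : ℕ in atTop, ∃ lam : TimeChange m, lam.logNorm ≤ ENNReal.ofReal (2 * K) ∧
      ∀ p ∈ P, ∀ t : Icc (0 : ℝ≥0) m, p ≤ gridFloor n t ↔ p ≤ lam t := by
  classical
  -- The endpoints are grid points; including them forces the displacement `ψ` to vanish at `0` and
  -- `m`.
  set Q : Finset ℝ≥0 := insert 0 (insert (m : ℝ≥0) P) with hQ
  have hQm : ∀ p ∈ Q, p ≤ m := by
    intro p hp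
    rcases Finset.mem_insert.1 hp with rfl | hp
    · exact zero_le
    rcases Finset.mem_insert.1 hp with rfl | hp
    · exact le_rfl
    · exact hP p hp
  obtain ⟨δ, hδ, hQδ⟩ := Q.exists_pos_le_dist
  -- Displacements `p - gridCeil n p` differ by at most `1 / n`, while distinct grid images stay `δ
  -- / 2` apart; this threshold makes the displacement `K`-Lipschitz.
  have hlim : ∀ᶠ n : ℕ in atTop, (1 : ℝ) / n < K * δ / 2 :=
    tendsto_one_div_atTop_nhds_zero_nat.eventually_lt_const (by positivity)
  filter_upwards [hlim, eventually_gt_atTop 0] with n hnlim hn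
  have hceil : ∀ p : ℝ≥0, (p : ℝ) ≤ gridCeil n p ∧ (gridCeil n p : ℝ) ≤ p + 1 / n := fun p =>
    ⟨by exact_mod_cast le_gridCeil hn p, by exact_mod_cast gridCeil_le_add hn p⟩
  have hlip : ∀ p ∈ Q, ∀ q ∈ Q, |((p : ℝ) - gridCeil n p) - (q - gridCeil n q)| ≤
      K * |(gridCeil n p : ℝ) - gridCeil n q| := by
    intro p hp q hq
    by_cases hpq : p = q
    · subst hpq; simp
    · have h1 := hQδ p hp q hq hpq
      rw [NNReal.dist_eq] at h1
      obtain ⟨a1, a2⟩ := hceil p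
      obtain ⟨b1, b2⟩ := hceil q
      have h2 : |((p : ℝ) - gridCeil n p) - (q - gridCeil n q)| ≤ 1 / n := by
        rw [abs_le]; constructor <;> linarith
      have h3 : |(p : ℝ) - q| ≤ |(gridCeil n p : ℝ) - gridCeil n q| + 1 / n := by
        have := abs_add_le ((gridCeil n p : ℝ) - gridCeil n q)
          (((p : ℝ) - gridCeil n p) - (q - gridCeil n q))
        have e : (gridCeil n p : ℝ) - gridCeil n q +
          (((p : ℝ) - gridCeil n p) - (q - gridCeil n q)) = p - q := by ring
        rw [e] at this
        linarith
      have hKr : (0 : ℝ) < K := hK0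
      have h4 : δ / 2 ≤ |(gridCeil n p : ℝ) - gridCeil n q| := by nlinarith
      nlinarith
  have hinj : InjOn (gridCeil n) (Q : Set ℝ≥0) := by
    intro p hp q hq hpq
    have := hlip p hp q hq
    rw [hpq] at this
    have h' : (p : ℝ) - q = 0 := by simpa using this
    exact NNReal.coe_injective (sub_eq_zero.1 h')
  -- The displacement is prescribed on the finite set of grid images, where injectivity makes it
  -- well defined, and extended to the line with the same Lipschitz constant.
  obtain ⟨ψ, hψ, hψQ⟩ : ∃ ψ : ℝ → ℝ, LipschitzWith K ψ ∧
      ∀ p ∈ Q, ψ (gridCeil n p) = p - gridCeil n p := by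
    let g : ℝ≥0 → ℝ := fun p => (gridCeil n p : ℝ)
    have hg : InjOn g (Q : Set ℝ≥0) := fun p hp q hq h => hinj hp hq (NNReal.coe_injective h)
    let χ : ℝ → ℝ := fun y => ((Function.invFunOn g (Q : Set ℝ≥0) y : ℝ≥0) : ℝ) - y
    have hχ : ∀ p ∈ Q, χ (g p) = p - gridCeil n p := fun p hp => by
      have := hg.leftInvOn_invFunOn hp
      show ((Function.invFunOn g (Q : Set ℝ≥0) (g p) : ℝ≥0) : ℝ) - g p = _
      rw [this]
    have hχlip : LipschitzOnWith K χ (g '' (Q : Set ℝ≥0)) := by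
      refine LipschitzOnWith.of_dist_le_mul ?_
      rintro _ ⟨p, hp, rfl⟩ _ ⟨q, hq, rfl⟩
      rw [hχ p hp, hχ q hq, Real.dist_eq, Real.dist_eq]
      exact hlip p hp q hq
    obtain ⟨ψ, hψ, heq⟩ := hχlip.extend_real
    exact ⟨ψ, hψ, fun p hp => (heq ⟨p, hp, rfl⟩).symm.trans (hχ p hp)⟩
  have h0 : ψ 0 = 0 := by
    have h1 : gridCeil n 0 = 0 := by simpa using gridCeil_natCast hn 0
    simpa [h1] using hψQ 0 (Finset.mem_insert_self _ _)
  have hm : ψ m = 0 := by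
    simpa [gridCeil_natCast hn m] using hψQ m
      (Finset.mem_insert_of_mem (Finset.mem_insert_self _ _))
  obtain ⟨lam, hlam, hval⟩ := exists_timeChange_of_lipschitz hK hψ h0 hm
  refine ⟨lam, hlam, fun p hp t => ?_⟩
  have hpQ : p ∈ Q := Finset.mem_insert_of_mem (Finset.mem_insert_of_mem hp)
  have hpm : gridCeil n p ≤ m := by
    rw [gridCeil_le_iff hn]
    exact (hQm p hpQ).trans ((gridCeil_le_iff hn).1 (gridCeil_natCast hn m).le)
  let c : Icc (0 : ℝ≥0) m := ⟨gridCeil n p, zero_le, hpm⟩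
  have hc : (lam c : ℝ≥0) = p := by
    apply NNReal.coe_injective
    rw [hval, hψQ p hpQ]
    ring
  rw [← gridCeil_le_iff hn]
  calc gridCeil n p ≤ t ↔ c ≤ t := Iff.rfl
    _ ↔ lam c ≤ lam t := lam.le_iff_le.symm
    _ ↔ p ≤ lam t := by rw [← Subtype.coe_le_coe, hc]

variable {E : Type*} [NormedAddCommGroup E]

/-- The path that is constant on the cells of the grid of mesh `1 / n`, with prescribed values. -/
def stepPath (n : ℕ) (c : ℕ → E) : CadlagPath E where
  toFun t := c ⌊(n : ℝ≥0) * gridFloor n t⌋₊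
  isCadlag' := isCadlag_comp_gridFloor n fun s => c ⌊(n : ℝ≥0) * s⌋₊

theorem stepPath_sample_apply {n : ℕ} (hn : 0 < n) (f : ℝ≥0 → E) (t : ℝ≥0) :
    stepPath n (fun j => f ((j : ℝ≥0) / n)) t = f (gridFloor n t) := by
  have hn' : (n : ℝ≥0) ≠ 0 := by exact_mod_cast hn.ne'
  show f ((⌊(n : ℝ≥0) * gridFloor n t⌋₊ : ℝ≥0) / n) = _
  congr 1
  rw [gridFloor, mul_div_cancel₀ _ hn', Nat.floor_natCast]

variable [NormedSpace ℝ E]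

/-- Only finitely many of the values matter on a compact interval. -/
theorem continuous_stepPath (n : ℕ) : Continuous (stepPath n : (ℕ → E) → CadlagPath E) := by
  refine continuous_iff_continuousAt.2 fun c => ?_
  refine CadlagPath.tendsto_of_tendstoUniformlyOn fun T => Metric.tendstoUniformlyOn_iff.2
    fun ε hε => ?_
  have h : ∀ᶠ c' in 𝓝 c, ∀ j ∈ Finset.range (⌊(n : ℝ≥0) * T⌋₊ + 1), dist (c' j) (c j) < ε := by
    rw [Filter.eventually_all_finset]
    exact fun j _ => (continuous_apply j).tendsto c |>.eventually (Metric.ball_mem_nhds _ hε)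
  filter_upwards [h] with c' hc' t ht
  rw [dist_comm]
  refine hc' _ (Finset.mem_range.2 (Nat.lt_succ_of_le (Nat.floor_mono ?_)))
  exact mul_le_mul_right ((gridFloor_le t).trans ht) _

/-- Sampling delays a jump at `p` to `gridCeil n p`. A time change sends these times back to `p`,
after which no partition point separates `gridFloor n t` from `lam t`, so `f` oscillates little
between them. -/
theorem CadlagPath.tendsto_stepPath_sample (f : CadlagPath E) :
    Tendsto (fun n : ℕ => stepPath n fun j => f ((j : ℝ≥0) / n)) atTop (𝓝 f) := by
  refine CadlagPath.tendsto_nhds_iff.2 fun k => tendsto_skorokhodDistOn_zero fun ε hε => ?_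
  set m : ℕ := k + 1 with hm
  obtain ⟨C, hC⟩ := f.isCadlag'.exists_bound m
  have hC0 : 0 ≤ C := (norm_nonneg _).trans (hC 0 ⟨le_rfl, zero_le⟩)
  -- The budget is `η` for the oscillation plus displacement times `C` for the cut-off factor; `η ≤
  -- 1` allows the Lipschitz constant `K = η / 2`.
  obtain ⟨η, hη, hη1, hηε⟩ : ∃ η : ℝ, 0 < η ∧ η ≤ 1 ∧ η + m * (Real.exp η - 1) * C ≤ ε := by
    have hc : Tendsto (fun η : ℝ => η + m * (Real.exp η - 1) * C) (𝓝 0) (𝓝 0) := by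
      have : Continuous fun η : ℝ => η + m * (Real.exp η - 1) * C := by fun_prop
      simpa using this.tendsto 0
    have hev : ∀ᶠ η in 𝓝[>] (0 : ℝ), 0 < η ∧ η ≤ 1 ∧ η + m * (Real.exp η - 1) * C ≤ ε := by
      filter_upwards [self_mem_nhdsWithin, mem_nhdsWithin_of_mem_nhds (Iic_mem_nhds one_pos),
        nhdsWithin_le_nhds (hc.eventually_le_const hε)] with η h1 h2 h3 using ⟨h1, h2, h3⟩
    exact hev.exists
  have hexp : 0 ≤ Real.exp η - 1 := by linarith [Real.add_one_le_exp η]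
  obtain ⟨S, hS⟩ := f.isCadlag'.exists_partition hη m
  have hKη : (((η / 2).toNNReal : ℝ≥0) : ℝ) = η / 2 := Real.coe_toNNReal _ (by positivity)
  filter_upwards [exists_timeChange_gridCeil (m := m) (S.filter (· ≤ (m : ℝ≥0)))
    (fun p hp => (Finset.mem_filter.1 hp).2) (K := (η / 2).toNNReal)
    (Real.toNNReal_pos.2 (by positivity)) (by rw [hKη]; linarith), eventually_gt_atTop 0] with
    n ⟨lam, hlam, hsep⟩ hn
  rw [hKη, mul_div_cancel₀ _ two_ne_zero] at hlam
  have hηε' : η ≤ ε := by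
    have : 0 ≤ (m : ℝ) * (Real.exp η - 1) * C := by positivity
    linarith
  refine ⟨lam, hlam.trans (ENNReal.ofReal_le_ofReal hηε'), fun t => ?_⟩
  refine (dist_cutAt_cutAt_le _ _ _ _ _).trans ?_
  have h1 : dist (stepPath n (fun j => f ((j : ℝ≥0) / n)) t) (f (lam t)) ≤ η := by
    rw [stepPath_sample_apply hn]
    have ht : gridFloor n t ≤ m := (gridFloor_le _).trans t.2.2
    rcases le_total (gridFloor n t) (lam t : ℝ≥0) with h | h
    · refine hS _ _ h (lam t).2.2 fun x hx hx' => ?_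
      exact hx'.1.not_ge ((hsep x (Finset.mem_filter.2 ⟨hx, hx'.2.trans (lam t).2.2⟩) t).2 hx'.2)
    · rw [dist_comm]
      refine hS _ _ h ht fun x hx hx' => ?_
      exact hx'.1.not_ge ((hsep x (Finset.mem_filter.2 ⟨hx, hx'.2.trans ht⟩) t).1 hx'.2)
  have h2 := lam.abs_apply_sub_le hη.le hlam t
  rw [abs_sub_comm] at h2
  have h3 := mul_le_mul h2 (hC _ (lam t).2) (norm_nonneg _) (by positivity)
  exact (add_le_add h1 h3).trans hηε

end GridApproximation

/-! ### Borel measurability of `Φₙ`. -/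

section Measurability

variable {E : Type*} [NormedAddCommGroup E] [NormedSpace ℝ E]

theorem CadlagPath.continuous_primitive_apply (t : ℝ≥0) :
    Continuous fun f : CadlagPath E => primitive f t :=
  continuous_iff_continuousAt.2 fun f =>
    (CadlagPath.tendstoUniformlyOn_primitive (tendsto_id (x := 𝓝 f)) t).tendsto_at
      (mem_Iic.2 le_rfl)

theorem CadlagPath.continuous_discrete_double_primitive_apply (n : ℕ) (t : ℝ≥0) :
    Continuous fun f : CadlagPath E => primitive (fun r => primitive f (gridFloor n r)) t := by
  refine continuous_iff_continuousAt.2 fun f => ?_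
  have h : TendstoUniformlyOn (fun (g : CadlagPath E) r => primitive g (gridFloor n r))
      (fun r => primitive f (gridFloor n r)) (𝓝 f) (Iic t) :=
    ((CadlagPath.tendstoUniformlyOn_primitive (tendsto_id (x := 𝓝 f)) t).comp
      (gridFloor n)).mono fun r hr => (gridFloor_le r).trans hr
  exact (_root_.tendstoUniformlyOn_primitive (fun g : CadlagPath E => isCadlag_comp_gridFloor n (primitive g.toFun))
    (isCadlag_comp_gridFloor n (primitive f.toFun)) h).tendsto_at (mem_Iic.2 le_rfl)

theorem IsCadlag.tendsto_average [CompleteSpace E] {f : ℝ≥0 → E} (hf : IsCadlag f) (t : ℝ≥0) :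
    Tendsto (fun k : ℕ => ((k : ℝ) + 1) • (primitive f (t + 1 / ((k : ℝ≥0) + 1)) - primitive f t))
      atTop (𝓝 (f t)) := by
  refine Metric.tendsto_nhds.2 fun ε hε => ?_
  obtain ⟨δ, hδ, hf'⟩ := Metric.continuousWithinAt_iff.1 (hf t).1 (ε / 2) (half_pos hε)
  filter_upwards [(tendsto_one_div_add_atTop_nhds_zero_nat (𝕜 := ℝ)).eventually_lt_const hδ]
    with k hk
  have hk0 : (0 : ℝ) < (k : ℝ) + 1 := by positivity
  set h : ℝ := 1 / ((k : ℝ) + 1) with hh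
  have hh0 : 0 < h := by positivity
  have hcoe : ((t + 1 / ((k : ℝ≥0) + 1) : ℝ≥0) : ℝ) = t + h := by push_cast; rfl
  have key : ‖(∫ s in (t : ℝ)..(t + h), f s.toNNReal) - h • f t‖ ≤ ε / 2 * h := by
    have e : h • f t = ∫ _ in (t : ℝ)..(t + h), f t := by
      rw [intervalIntegral.integral_const, add_sub_cancel_left]
    rw [e, ← intervalIntegral.integral_sub (hf.intervalIntegrable _ _) intervalIntegrable_const]
    refine (intervalIntegral.norm_integral_le_of_norm_le_const (C := ε / 2) fun s hs => ?_).trans ?_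
    · rw [uIoc_of_le (by linarith)] at hs
      have hs0 : 0 ≤ s := t.coe_nonneg.trans hs.1.le
      have hst : t ≤ s.toNNReal := NNReal.le_toNNReal_of_coe_le hs.1.le
      rw [← dist_eq_norm]
      refine (hf' hst ?_).le
      rw [NNReal.dist_eq, Real.coe_toNNReal _ hs0, abs_of_pos (by linarith [hs.1])]
      linarith [hs.2]
    · rw [add_sub_cancel_left, abs_of_pos hh0]
  rw [primitive, primitive, intervalIntegral.integral_interval_sub_left
    (hf.intervalIntegrable _ _) (hf.intervalIntegrable _ _), hcoe, dist_eq_norm]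
  have hkh : ((k : ℝ) + 1) * h = 1 := by rw [hh]; field_simp
  have e2 : ((k : ℝ) + 1) • (∫ s in (t : ℝ)..(t + h), f s.toNNReal) - f t =
      ((k : ℝ) + 1) • ((∫ s in (t : ℝ)..(t + h), f s.toNNReal) - h • f t) := by
    rw [smul_sub, smul_smul, hkh, one_smul]
  rw [e2, norm_smul, Real.norm_of_nonneg hk0.le]
  calc ((k : ℝ) + 1) * _ ≤ ((k : ℝ) + 1) * (ε / 2 * h) := mul_le_mul_of_nonneg_left key hk0.le
    _ = ε / 2 * (((k : ℝ) + 1) * h) := by ring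
    _ < ε := by rw [hkh]; linarith

/-- Evaluation need not be `J₁`-continuous, but right continuity makes it a limit of averages over
`[t, t + 1/(k+1)]`, which are continuous in the path. -/
theorem CadlagPath.measurable_apply [CompleteSpace E] [MeasurableSpace E] [BorelSpace E]
    (t : ℝ≥0) : Measurable fun f : CadlagPath E => f t := by
  refine measurable_of_tendsto_metrizable (f := fun (k : ℕ) (f : CadlagPath E) =>
    ((k : ℝ) + 1) • (primitive f (t + 1 / ((k : ℝ≥0) + 1)) - primitive f t)) (fun k => ?_)
    (tendsto_pi_nhds.2 fun f => f.isCadlag'.tendsto_average t)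
  exact (((CadlagPath.continuous_primitive_apply _).sub
    (CadlagPath.continuous_primitive_apply _)).const_smul _).measurable

/-- The path is the limit of its grid samples, each a continuous function of countably many
evaluations; second countability identifies the product and Borel `σ`-algebras on `ℕ → E`. -/
theorem CadlagPath.measurable_of_apply [MeasurableSpace E] [BorelSpace E]
    [SecondCountableTopology E] {X : Type*} [MeasurableSpace X] {Ψ : X → CadlagPath E}
    (h : ∀ t, Measurable fun x => Ψ x t) : Measurable Ψ := by
  refine measurable_of_tendsto_metrizable
    (f := fun (k : ℕ) (x : X) => stepPath k fun j => Ψ x ((j : ℝ≥0) / k)) (fun k => ?_)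
    (tendsto_pi_nhds.2 fun x => CadlagPath.tendsto_stepPath_sample (Ψ x))
  exact (continuous_stepPath k).measurable.comp (measurable_pi_iff.2 fun j => h _)

/-- `Φₙ` can fail to be continuous, since its integral blocks jump at fixed grid times while jumps
of `f` may move; hence the route through coordinates. -/
theorem measurable_discreteIteratedIntegralMap {d : ℕ} (n : ℕ) :
    Measurable (discreteIteratedIntegralMap (d := d) n) := by
  refine CadlagPath.measurable_of_apply fun t => ?_
  exact (continuous_stack d).measurable.comp ((CadlagPath.measurable_apply t).prodMk
    ((CadlagPath.continuous_primitive_apply _).measurable.prodMk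
      (CadlagPath.continuous_discrete_double_primitive_apply n _).measurable))

end Measurability

/-! ### Uniform approximation of `Φ` by `Φₙ` on bounded sets of paths. -/

section Approximation

variable {E : Type*} [NormedAddCommGroup E] [NormedSpace ℝ E]

/-- The supremum of the norm of `f^{(m)}`. -/
def cutSup (m : ℕ) (f : ℝ≥0 → E) : ℝ≥0∞ := ⨆ t : Icc (0 : ℝ≥0) m, ‖cutAt m f t‖ₑ

/-- A time change permutes `[0, m]` and so leaves suprema unchanged. The complement serves as a
closed set in the portmanteau bound. -/
theorem isOpen_cutSup_lt (k : ℕ) (R : ℝ≥0∞) :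
    IsOpen {f : CadlagPath E | cutSup (k + 1) f < R} := by
  refine isOpen_iff_mem_nhds.2 fun f hf => ?_
  have hfin : cutSup (k + 1) f ≠ ⊤ := (lt_of_lt_of_le hf le_top).ne
  obtain ⟨ε, hε, hεR⟩ : ∃ ε : ℝ≥0, 0 < ε ∧ cutSup (k + 1) f + ε < R := by
    obtain ⟨r, hr, hr'⟩ := ENNReal.lt_iff_exists_add_pos_lt.1 hf
    exact ⟨r, hr, hr'⟩
  filter_upwards [exists_timeChange_of_tendsto (CadlagPath.tendsto_nhds_iff.1
    (tendsto_id (x := 𝓝 f)) k) (NNReal.coe_pos.2 hε)] with g ⟨lam, _, hlam⟩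
  refine lt_of_le_of_lt (iSup_le fun t => ?_) hεR
  have h1 : ‖cutAt (k + 1) f (lam t)‖ₑ ≤ cutSup (k + 1) f :=
    le_iSup (fun t : Icc (0 : ℝ≥0) ((k + 1 : ℕ) : ℝ≥0) => ‖cutAt (k + 1) f t‖ₑ) (lam t)
  have h2 : edist (cutAt (k + 1) g t) (cutAt (k + 1) f (lam t)) ≤ ε := by
    rw [edist_dist, ← ENNReal.ofReal_coe_nnreal]
    exact ENNReal.ofReal_le_ofReal (hlam t).1
  calc ‖cutAt (k + 1) g t‖ₑ = edist (cutAt (k + 1) g t) 0 := (edist_zero_right _).symm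
    _ ≤ edist (cutAt (k + 1) g t) (cutAt (k + 1) f (lam t)) + edist (cutAt (k + 1) f (lam t)) 0 :=
      edist_triangle _ _ _
    _ ≤ ε + cutSup (k + 1) f := add_le_add h2 ((edist_zero_right _).trans_le h1)
    _ = cutSup (k + 1) f + ε := add_comm _ _

theorem cutSup_lt_top (m : ℕ) (f : CadlagPath E) : cutSup m f < ⊤ := by
  obtain ⟨C, hC⟩ := f.isCadlag'.exists_bound m
  refine lt_of_le_of_lt (iSup_le fun t => ?_) (ENNReal.ofReal_lt_top (r := C))
  rw [← ofReal_norm]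
  exact ENNReal.ofReal_le_ofReal ((norm_cutAt_le _ _ _).trans (hC t t.2))

theorem norm_le_of_cutSup_lt {k : ℕ} {f : ℝ≥0 → E} {R : ℝ≥0} (h : cutSup (k + 1) f < R) {t : ℝ≥0}
    (ht : t ≤ k) : ‖f t‖ ≤ R := by
  have htk : t + 1 ≤ (k + 1 : ℕ) := by push_cast; gcongr
  have h1 : ‖cutAt (k + 1) f t‖ₑ ≤ cutSup (k + 1) f :=
    le_iSup (fun t : Icc (0 : ℝ≥0) ((k + 1 : ℕ) : ℝ≥0) => ‖cutAt (k + 1) f t‖ₑ)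
      ⟨t, zero_le, le_self_add.trans htk⟩
  rw [cutAt_of_add_one_le _ htk] at h1
  have h2 := h1.trans h.le
  rwa [enorm_eq_nnnorm, ENNReal.coe_le_coe, ← NNReal.coe_le_coe, coe_nnnorm] at h2

/-- The single integral contributes `R / n`; in the double integral, the inner rounding and the
shortened outer range contribute `R * M / n` each. -/
theorem dist_discrete_iteratedIntegral_le {d n M : ℕ} (hn : 0 < n)
    {f : CadlagPath (EuclideanSpace ℝ (Fin d))} {R : ℝ≥0} (hR : ∀ t ≤ (M : ℝ≥0), ‖f t‖ ≤ R)
    {t : ℝ≥0} (ht : t ≤ M) :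
    dist (discreteIteratedIntegralMap n f t) (iteratedIntegralMap f t) ≤
      R * (1 + 2 * M) / n := by
  have hn' : (0 : ℝ) < n := by exact_mod_cast hn
  have hR0 : (0 : ℝ) ≤ R := R.coe_nonneg
  have hF := f.isCadlag'.continuous_primitive
  have hgap : ∀ r : ℝ≥0, (r : ℝ) - gridFloor n r ≤ 1 / n := fun r => by
    linarith [le_gridFloor_add hn r]
  have hgt : (gridFloor n t : ℝ) ≤ M := by exact_mod_cast (gridFloor_le t).trans ht
  have h1 : ∀ r ≤ (M : ℝ≥0), ‖primitive f (gridFloor n r) - primitive f r‖ ≤ R * (1 / n) :=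
    fun r hr => (norm_primitive_sub_primitive_le f.isCadlag' (gridFloor_le r)
      fun s hs => hR s (hs.trans hr)).trans (mul_le_mul_of_nonneg_left (hgap r) hR0)
  have hFb : ∀ r ≤ (M : ℝ≥0), ‖primitive f r‖ ≤ R * M := fun r hr => by
    have h0 := norm_primitive_sub_primitive_le f.isCadlag' (s := 0) (t := r) zero_le
      fun s hs => hR s (hs.trans hr)
    have hr' : (r : ℝ) ≤ M := by exact_mod_cast hr
    have hz : primitive f.toFun 0 = 0 := by simp [primitive]
    rw [hz, zero_sub, norm_neg, NNReal.coe_zero, sub_zero] at h0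
    exact h0.trans (mul_le_mul_of_nonneg_left hr' hR0)
  have h2 : ‖primitive (fun r => primitive f (gridFloor n r)) (gridFloor n t) -
      primitive (fun r => primitive f r) (gridFloor n t)‖ ≤ R * (1 / n) * M :=
    (norm_primitive_sub_le_mul (isCadlag_comp_gridFloor n _) hF.isCadlag
      fun r hr => h1 r (hr.trans ((gridFloor_le t).trans ht))).trans
      (mul_le_mul_of_nonneg_left hgt (by positivity))
  have h3 : ‖primitive (fun r => primitive f r) (gridFloor n t) -
      primitive (fun r => primitive f r) t‖ ≤ R * M * (1 / n) :=
    (norm_primitive_sub_primitive_le hF.isCadlag (gridFloor_le t)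
      fun r hr => hFb r (hr.trans ht)).trans (mul_le_mul_of_nonneg_left (hgap t) (by positivity))
  refine (dist_stack_le _ _ _ _ _ _).trans ?_
  rw [dist_self, dist_eq_norm, dist_eq_norm]
  have h4 := (norm_sub_le_norm_sub_add_norm_sub _ _ _).trans (add_le_add h2 h3)
  refine (add_le_add (add_le_add le_rfl (h1 t ht)) h4).trans (le_of_eq ?_)
  field_simp
  ring

/-- `Φₙ` approximates `Φ` uniformly on sets of locally bounded paths. -/
theorem eventually_edist_discreteIteratedIntegralMap_le {d : ℕ} {ε : ℝ≥0∞} (hε : 0 < ε) :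
    ∃ M : ℕ, ∀ R : ℝ≥0, ∀ᶠ n : ℕ in atTop, ∀ f : CadlagPath (EuclideanSpace ℝ (Fin d)),
      cutSup (M + 1) f < R → edist (discreteIteratedIntegralMap n f) (iteratedIntegralMap f) ≤ ε := by
  -- The horizon depends only on the tail of the metric, so it is fixed before `R`; `cutSup (M + 1)`
  -- bounds the path on `[0, M]`.
  obtain ⟨M, hM⟩ : ∃ M : ℕ, (2⁻¹ : ℝ≥0∞) ^ M < ε / 2 := by
    have := ENNReal.tendsto_pow_atTop_nhds_zero_of_lt_one (r := 2⁻¹) (by simp)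
    exact (this.eventually_lt_const (ENNReal.half_pos hε.ne')).exists
  refine ⟨M, fun R => ?_⟩
  have hlim : Tendsto (fun n : ℕ => (M : ℝ≥0∞) * ENNReal.ofReal (R * (1 + 2 * M) / n)) atTop
      (𝓝 0) := by
    have h1 := ENNReal.tendsto_ofReal
      (tendsto_const_div_atTop_nhds_zero_nat ((R : ℝ) * (1 + 2 * M)))
    simpa using ENNReal.Tendsto.const_mul (a := (M : ℝ≥0∞)) h1 (Or.inr (by simp))
  filter_upwards [hlim.eventually_lt_const (ENNReal.half_pos hε.ne'), eventually_gt_atTop 0] with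
    n hn hn0 f hf
  refine (skorokhodDist_le_sum_add M _ _).trans ?_
  refine le_trans (add_le_add ?_ hM.le) ((add_le_add hn.le le_rfl).trans (ENNReal.add_halves ε).le)
  refine (Finset.sum_le_card_nsmul _ _ (ENNReal.ofReal (R * (1 + 2 * M) / n)) fun k hk => ?_).trans
    (by simp)
  refine skorokhodDistOn_cutAt_le fun t ht => ?_
  have hkM : ((k + 1 : ℕ) : ℝ≥0) ≤ M := by exact_mod_cast Finset.mem_range.1 hk
  exact dist_discrete_iteratedIntegral_le hn0 (fun s hs => norm_le_of_cutSup_lt hf hs)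
    (ht.trans hkM)

end Approximation

/-! ### Passage to the limit in law. -/

section WeakConvergence

/-- Each path has finite `cutSup`, so these sets decrease to the empty set; continuity from above
applies. -/
theorem tendsto_measure_le_cutSup {E : Type*} [NormedAddCommGroup E] [NormedSpace ℝ E] (k : ℕ)
    (ν : Measure (CadlagPath E)) [IsFiniteMeasure ν] :
    Tendsto (fun R : ℕ => ν {f | cutSup (k + 1) f < ((R : ℝ≥0) : ℝ≥0∞)}ᶜ) atTop (𝓝 0) := by
  have hempty : ⋂ R : ℕ, {f : CadlagPath E | cutSup (k + 1) f < ((R : ℝ≥0) : ℝ≥0∞)}ᶜ = ∅ := by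
    refine eq_empty_of_forall_notMem fun f hf => ?_
    obtain ⟨R, hR⟩ := ENNReal.exists_nat_gt (cutSup_lt_top (k + 1) f).ne
    exact mem_iInter.1 hf R (by simpa using hR)
  have h := tendsto_measure_iInter_atTop (μ := ν)
    (s := fun R : ℕ => {f : CadlagPath E | cutSup (k + 1) f < ((R : ℝ≥0) : ℝ≥0∞)}ᶜ)
    (fun R => (isOpen_cutSup_lt k _).measurableSet.compl.nullMeasurableSet)
    (fun R R' hRR' => compl_subset_compl.2 fun f (hf : cutSup (k + 1) f < _) =>
      hf.trans_le (by exact_mod_cast hRR'))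
    ⟨0, measure_ne_top _ _⟩
  rwa [hempty, measure_empty] at h

/-- For large `n`, `Φₙ f ∈ F` forces `Φ f` into the closed `ε`-thickening of `F`, unless `cutSup (M
+ 1) f ≥ R`. Both alternatives are closed conditions on `f`, so portmanteau for `μ` applies. -/
theorem limsup_measure_preimage_le {d : ℕ}
    {μ : ℕ → ProbabilityMeasure (CadlagPath (EuclideanSpace ℝ (Fin d)))}
    {ν : ProbabilityMeasure (CadlagPath (EuclideanSpace ℝ (Fin d)))}
    (h : Tendsto μ atTop (𝓝 ν)) {F : Set (CadlagPath (EuclideanSpace ℝ (Fin (3 * d))))}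
    (hF : IsClosed F) :
    limsup (fun n => (μ n : Measure (CadlagPath (EuclideanSpace ℝ (Fin d))))
      (discreteIteratedIntegralMap n ⁻¹' F)) atTop ≤
      (ν : Measure (CadlagPath (EuclideanSpace ℝ (Fin d)))) (iteratedIntegralMap ⁻¹' F) := by
  have hΦ := continuous_iteratedIntegralMap (d := d)
  have hthick : ∀ ε : ℝ, 0 < ε → limsup (fun n =>
      (μ n : Measure (CadlagPath (EuclideanSpace ℝ (Fin d))))
      (discreteIteratedIntegralMap n ⁻¹' F)) atTop ≤
      (ν : Measure (CadlagPath (EuclideanSpace ℝ (Fin d)))) (iteratedIntegralMap ⁻¹' Metric.cthickening ε F) := by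
    intro ε hε
    obtain ⟨M, hM⟩ := eventually_edist_discreteIteratedIntegralMap_le (d := d)
      (ENNReal.ofReal_pos.2 hε)
    have hR : ∀ R : ℕ, limsup (fun n =>
        (μ n : Measure (CadlagPath (EuclideanSpace ℝ (Fin d))))
        (discreteIteratedIntegralMap n ⁻¹' F)) atTop ≤
        (ν : Measure (CadlagPath (EuclideanSpace ℝ (Fin d)))) (iteratedIntegralMap ⁻¹' Metric.cthickening ε F) +
          (ν : Measure (CadlagPath (EuclideanSpace ℝ (Fin d)))) {f | cutSup (M + 1) f < ((R : ℝ≥0) : ℝ≥0∞)}ᶜ := by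
      intro R
      refine le_trans ?_ (measure_union_le _ _)
      refine le_trans ?_ (ProbabilityMeasure.limsup_measure_closed_le_of_tendsto h
        ((Metric.isClosed_cthickening.preimage hΦ).union (isOpen_cutSup_lt M _).isClosed_compl))
      refine limsup_le_limsup ?_
      filter_upwards [hM R] with n hn
      refine measure_mono fun f hf => ?_
      by_cases hfR : cutSup (M + 1) f < ((R : ℝ≥0) : ℝ≥0∞)
      · refine Or.inl (Metric.mem_cthickening_of_edist_le _ _ _ _ hf ?_)
        rw [edist_comm]
        exact hn f hfR
      · exact Or.inr hfR
    -- Letting `R → ∞` removes the large paths, using only the limit law.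
    refine ge_of_tendsto' (x := atTop) ?_ hR
    simpa using tendsto_const_nhds.add (tendsto_measure_le_cutSup M (ν : Measure (CadlagPath (EuclideanSpace ℝ (Fin d)))))
  -- Letting `ε ↓ 0`, the closed thickenings decrease to the closed set `F`.
  have hlim := tendsto_measure_cthickening_of_isClosed (μ := (ν : Measure (CadlagPath (EuclideanSpace ℝ (Fin d)))).map iteratedIntegralMap)
    ⟨1, one_pos, measure_ne_top _ _⟩ hF
  rw [Measure.map_apply hΦ.measurable hF.measurableSet] at hlim
  refine ge_of_tendsto (hlim.mono_left (nhdsWithin_le_nhds (s := Ioi 0))) ?_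
  filter_upwards [self_mem_nhdsWithin] with ε hε
  rw [Measure.map_apply hΦ.measurable Metric.isClosed_cthickening.measurableSet]
  exact hthick ε hε

end WeakConvergence

end

theorem lemmaD9 (d : ℕ)
    {Ω : ℕ → Type*} [∀ n, MeasurableSpace (Ω n)] (P : ∀ n, Measure (Ω n))
    [∀ n, IsProbabilityMeasure (P n)]
    {Ω' : Type*} [MeasurableSpace Ω'] (P' : Measure Ω') [IsProbabilityMeasure P']
    (U : ∀ n, Ω n → CadlagPath (EuclideanSpace ℝ (Fin d)))
    (V : Ω' → CadlagPath (EuclideanSpace ℝ (Fin d)))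
    (hVcont : ∀ᵐ ω ∂P', Continuous (V ω).toFun)
    (hUV : TendstoInDistribution U atTop V P P') :
    TendstoInDistribution (fun n ω => discreteIteratedIntegralMap n (U n ω)) atTop
      (fun ω => iteratedIntegralMap (V ω)) P P' := by

  have hΦn := fun n => measurable_discreteIteratedIntegralMap (d := d) n
  have hΦ := (continuous_iteratedIntegralMap (d := d)).measurable
  refine ⟨fun n => (hΦn n).comp_aemeasurable (hUV.forall_aemeasurable n),
    hΦ.comp_aemeasurable hUV.aemeasurable_limit, ?_⟩
  refine tendsto_of_forall_isClosed_limsup_le' fun F hF => ?_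
  have key := limsup_measure_preimage_le hUV.tendsto hF
  simp only [ProbabilityMeasure.coe_mk] at key ⊢
  have h1 : ∀ n, (P n).map (fun ω => discreteIteratedIntegralMap n (U n ω)) F =
      (P n).map (U n) (discreteIteratedIntegralMap n ⁻¹' F) := fun n => by
    rw [← Measure.map_apply (hΦn n) hF.measurableSet,
      AEMeasurable.map_map_of_aemeasurable (hΦn n).aemeasurable (hUV.forall_aemeasurable n)]
    rfl
  have h2 : P'.map (fun ω => iteratedIntegralMap (V ω)) F =
      P'.map V (iteratedIntegralMap ⁻¹' F) := by
    rw [← Measure.map_apply hΦ hF.measurableSet,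
      AEMeasurable.map_map_of_aemeasurable hΦ.aemeasurable hUV.aemeasurable_limit]
    rfl
  simp only [h1, h2]
  exact key
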